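/- Let $r\ge 1$ and $n\ge 0$ be integers, let $V=\mathbb C^r$, and let $\mathfrak g=\mathfrak{sl}_r$ or $\mathfrak g=\mathfrak{gl}_r$, with Borel subalgebra $\mathfrak b\subset\mathfrak g$ of upper triangular matrices. Let $A$ be a finitely generated commutative unital $\mathbb C$-algebra with an augmentation $\epsilon:A\to\mathbb C$ (a homomorphism of $\mathbb C$-algebras). Let $\omega_1$ be the weight reading off the first diagonal entry, extended to $\mathfrak b$ by zero on strictly upper triangular matrices. A vector $v$ of a $\mathfrak g\otimes A$-module is called a highest weight vector of weight $\lambda$ if $(x\otimes P)v=\lambda(x)\epsilon(P)v$ for all $x\in\mathfrak b$, $P\in A$. The Weyl module $W^A_\epsilon(\lambda)$ is the universal finite-dimensional $\mathfrak g\otimes A$-module generated by a highest weight vector $v_\lambda$ of weight $\lambda$: every finite-dimensional module generated by a highest weight vector of weight $\lambda$ is a quotient of it, with $v_\lambda$ mapped to the generator. Let $S^n(A)=(A^{\otimes n})^{\Sigma_n}$, let $S^n(A)_\epsilon$ be the kernel of $\epsilon^{\otimes n}$ on $S^n(A)$, and let $$DH_n(A)=A^{\otimes n}\big/\,S^n(A)_\epsilon\cdot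 A^{\otimes n}$$ be the space of diagonal harmonics, on which $A^{\otimes n}$ acts by multiplication and $\Sigma_n$ by permuting the factors. Let $\nabla_n^r(DH_n(A))=(V^{\otimes n}\otimes DH_n(A))^{\Sigma_n}$, with $\Sigma_n$ acting diagonally and with $\mathfrak g\otimes A$ acting by $$(x\otimes P)(u_1\otimes\dots\otimes u_n\otimes h)=\sum_{k=1}^n u_1\otimes\dots\otimes x(u_k)\otimes\dots\otimes u_n\otimes\iota_k(P)h,$$ where $\iota_k:A\to A^{\otimes n}$ is the inclusion as the $k$-th factor. Then the Weyl module $W^A_\epsilon(n\omega_1)$ exists and there is an isomorphism of $\mathfrak g\otimes A$-modules $$W^A_\epsilon(n\omega_1)\;\cong\;\nabla_n^r\left(DH_n(A)\right).$$ -/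

import Mathlib

open scoped TensorProduct

attribute [local instance 100] LieRing.ofAssociativeRing

universe u v w

noncomputable section

namespace WeylDuality

/-! ### Lie algebras of matrices, currents, highest weight vectors -/

/-- `𝔤𝔩_r`, the Lie algebra of complex `r × r` matrices. -/
abbrev gl (r : ℕ) : LieSubalgebra ℂ (Matrix (Fin r) (Fin r) ℂ) := ⊤

/-- `𝔰𝔩_r`, the Lie algebra of traceless complex `r × r` matrices. -/
abbrev sl (r : ℕ) : LieSubalgebra ℂ (Matrix (Fin r) (Fin r) ℂ) :=
  LieAlgebra.SpecialLinear.sl (Fin r) ℂ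

/-- The standard Borel subalgebra of `𝔤𝔩_r`: upper triangular matrices. The Borel subalgebra of
`𝔤 = 𝔰𝔩_r` or `𝔤𝔩_r` is its intersection with `𝔤`. -/
def borel (r : ℕ) : LieSubalgebra ℂ (Matrix (Fin r) (Fin r) ℂ) where
  carrier := {x | x.BlockTriangular id}
  add_mem' hx hy := Matrix.BlockTriangular.add hx hy
  zero_mem' := Matrix.blockTriangular_zero
  smul_mem' c x hx := fun i j h => by simp [hx h]
  lie_mem' {x y} hx hy := by
    rw [Ring.lie_def]
    exact Matrix.BlockTriangular.sub (Matrix.BlockTriangular.mul hx hy)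
      (Matrix.BlockTriangular.mul hy hx)

/-- The value at `x ∈ 𝔟` of the weight `∑ lam_i ε_i`, where `ε_i` reads the `i`-th diagonal entry
(weights are extended from the diagonal matrices to `𝔟` by zero on strictly upper triangular
matrices). -/
def weightEval {r : ℕ} (lam : Fin r → ℂ) (x : Matrix (Fin r) (Fin r) ℂ) : ℂ :=
  ∑ i, lam i * x i i

/-- The first fundamental weight `ω₁ = ε_1` (for `𝔰𝔩_r`, the restriction of `ε_1`). -/
def omegaOne (r : ℕ) [NeZero r] : Fin r → ℂ := Pi.single 0 1

variable {r : ℕ} {A : Type u} [CommRing A] [Algebra ℂ A]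

/-- `v` is a highest weight vector of weight `lam` with respect to the augmentation `ε`:
`(x ⊗ P) v = lam(x) ε(P) v` for all `x ∈ 𝔟`, `P ∈ A`. -/
def IsHighestWeightVector (𝔤 : LieSubalgebra ℂ (Matrix (Fin r) (Fin r) ℂ)) (ε : A →ₐ[ℂ] ℂ)
    (lam : Fin r → ℂ) {M : Type v} [AddCommGroup M] [Module ℂ M]
    [LieRingModule (A ⊗[ℂ] 𝔤) M] (m : M) : Prop :=
  ∀ x : 𝔤, (x : Matrix (Fin r) (Fin r) ℂ) ∈ borel r → ∀ P : A,
    ⁅(P ⊗ₜ[ℂ] x : A ⊗[ℂ] 𝔤), m⁆ = (weightEval lam x * ε P) • m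

/-- `M`, with the vector `m`, is the universal finite-dimensional `𝔤 ⊗ A`-module generated by a
highest weight vector of weight `lam`: every finite-dimensional module generated by such a vector
is a quotient of `M`. -/
structure IsWeylModule (𝔤 : LieSubalgebra ℂ (Matrix (Fin r) (Fin r) ℂ)) (ε : A →ₐ[ℂ] ℂ)
    (lam : Fin r → ℂ) (M : Type v) [AddCommGroup M] [Module ℂ M]
    [LieRingModule (A ⊗[ℂ] 𝔤) M] [LieModule ℂ (A ⊗[ℂ] 𝔤) M] (m : M) : Prop where
  finite : Module.Finite ℂ M
  highest : IsHighestWeightVector 𝔤 ε lam m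
  generated : LieSubmodule.lieSpan ℂ (A ⊗[ℂ] 𝔤) {m} = ⊤
  universal : ∀ (N : Type w) [AddCommGroup N] [Module ℂ N] [LieRingModule (A ⊗[ℂ] 𝔤) N]
    [LieModule ℂ (A ⊗[ℂ] 𝔤) N] (y : N), Module.Finite ℂ N → IsHighestWeightVector 𝔤 ε lam y →
    LieSubmodule.lieSpan ℂ (A ⊗[ℂ] 𝔤) {y} = ⊤ →
    ∃ f : M →ₗ⁅ℂ, A ⊗[ℂ] 𝔤⁆ N, f m = y ∧ Function.Surjective f

/-! ### The Weyl module -/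

/-- The highest weight relations `(P ⊗ x) - lam(x) ε(P)`, `x ∈ 𝔟`, `P ∈ A`, in the universal
enveloping algebra of `𝔤 ⊗ A`. -/
def weylRelations (𝔤 : LieSubalgebra ℂ (Matrix (Fin r) (Fin r) ℂ)) (ε : A →ₐ[ℂ] ℂ)
    (lam : Fin r → ℂ) : Set (UniversalEnvelopingAlgebra ℂ (A ⊗[ℂ] 𝔤)) :=
  {t | ∃ (x : 𝔤) (P : A), (x : Matrix (Fin r) (Fin r) ℂ) ∈ borel r ∧
    t = UniversalEnvelopingAlgebra.ι ℂ (P ⊗ₜ[ℂ] x : A ⊗[ℂ] 𝔤) -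
      algebraMap ℂ _ (weightEval lam x * ε P)}

/-- The intersection of all left ideals of finite codimension in `U(𝔤 ⊗ A)` containing the highest
weight relations; these left ideals are exactly the annihilators of the generators of
finite-dimensional modules generated by a highest weight vector. -/
def weylIdeal (𝔤 : LieSubalgebra ℂ (Matrix (Fin r) (Fin r) ℂ)) (ε : A →ₐ[ℂ] ℂ)
    (lam : Fin r → ℂ) : Submodule (UniversalEnvelopingAlgebra ℂ (A ⊗[ℂ] 𝔤))
      (UniversalEnvelopingAlgebra ℂ (A ⊗[ℂ] 𝔤)) :=
  sInf {I | weylRelations 𝔤 ε lam ⊆ I ∧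
    Module.Finite ℂ (UniversalEnvelopingAlgebra ℂ (A ⊗[ℂ] 𝔤) ⧸ I)}

/-- The Weyl module `W^A_ε(lam)` of `𝔤 ⊗ A`. -/
def WeylModule (𝔤 : LieSubalgebra ℂ (Matrix (Fin r) (Fin r) ℂ)) (ε : A →ₐ[ℂ] ℂ)
    (lam : Fin r → ℂ) : Type u :=
  UniversalEnvelopingAlgebra ℂ (A ⊗[ℂ] 𝔤) ⧸ weylIdeal 𝔤 ε lam

namespace WeylModule

variable (𝔤 : LieSubalgebra ℂ (Matrix (Fin r) (Fin r) ℂ)) (ε : A →ₐ[ℂ] ℂ) (lam : Fin r → ℂ)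

instance : AddCommGroup (WeylModule 𝔤 ε lam) :=
  inferInstanceAs (AddCommGroup (UniversalEnvelopingAlgebra ℂ (A ⊗[ℂ] 𝔤) ⧸ weylIdeal 𝔤 ε lam))

instance : Module (UniversalEnvelopingAlgebra ℂ (A ⊗[ℂ] 𝔤)) (WeylModule 𝔤 ε lam) :=
  inferInstanceAs (Module (UniversalEnvelopingAlgebra ℂ (A ⊗[ℂ] 𝔤))
    (UniversalEnvelopingAlgebra ℂ (A ⊗[ℂ] 𝔤) ⧸ weylIdeal 𝔤 ε lam))

instance : Module ℂ (WeylModule 𝔤 ε lam) :=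
  inferInstanceAs (Module ℂ (UniversalEnvelopingAlgebra ℂ (A ⊗[ℂ] 𝔤) ⧸ weylIdeal 𝔤 ε lam))

instance : IsScalarTower ℂ (UniversalEnvelopingAlgebra ℂ (A ⊗[ℂ] 𝔤)) (WeylModule 𝔤 ε lam) :=
  inferInstanceAs (IsScalarTower ℂ (UniversalEnvelopingAlgebra ℂ (A ⊗[ℂ] 𝔤))
    (UniversalEnvelopingAlgebra ℂ (A ⊗[ℂ] 𝔤) ⧸ weylIdeal 𝔤 ε lam))

/-- `𝔤 ⊗ A` acts through left multiplication in its enveloping algebra. -/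
instance : LieRingModule (A ⊗[ℂ] 𝔤) (WeylModule 𝔤 ε lam) where
  bracket z m := UniversalEnvelopingAlgebra.ι ℂ z • m
  add_lie x y m := by
    change UniversalEnvelopingAlgebra.ι ℂ (x + y) • m = _
    rw [map_add]
    exact add_smul _ _ m
  lie_add x m m' := smul_add (UniversalEnvelopingAlgebra.ι ℂ x) m m'
  leibniz_lie x y m := by
    change UniversalEnvelopingAlgebra.ι ℂ x • UniversalEnvelopingAlgebra.ι ℂ y • m =
      UniversalEnvelopingAlgebra.ι ℂ ⁅x, y⁆ • m +
        UniversalEnvelopingAlgebra.ι ℂ y • UniversalEnvelopingAlgebra.ι ℂ x • m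
    rw [LieHom.map_lie, Ring.lie_def, sub_smul, mul_smul, mul_smul, sub_add_cancel]

instance : LieModule ℂ (A ⊗[ℂ] 𝔤) (WeylModule 𝔤 ε lam) where
  smul_lie c x m := by
    change UniversalEnvelopingAlgebra.ι ℂ (c • x) • m = c • UniversalEnvelopingAlgebra.ι ℂ x • m
    rw [map_smul, smul_assoc]
  lie_smul c x m := by
    change UniversalEnvelopingAlgebra.ι ℂ x • c • m = c • UniversalEnvelopingAlgebra.ι ℂ x • m
    rw [← algebraMap_smul (UniversalEnvelopingAlgebra ℂ (A ⊗[ℂ] 𝔤)) c m,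
      ← algebraMap_smul (UniversalEnvelopingAlgebra ℂ (A ⊗[ℂ] 𝔤)) c
        (UniversalEnvelopingAlgebra.ι ℂ x • m), ← mul_smul, ← mul_smul, Algebra.commutes]

/-- The generating highest weight vector, the class of `1`. -/
def gen : WeylModule 𝔤 ε lam := Submodule.Quotient.mk 1

end WeylModule

/-! ### Permutations of tensor factors, representations of the wreath product -/

/-- The action of `Σ_n` on `X^{⊗n}` by permutation of factors:
`(σ t)` has `x_{σ⁻¹(i)}` at the place `i` for `t = x_1 ⊗ ⋯ ⊗ x_n`. -/
def tensorPerm (n : ℕ) (X : Type v) [AddCommGroup X] [Module ℂ X] :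
    Representation ℂ (Equiv.Perm (Fin n)) (⨂[ℂ] _ : Fin n, X) where
  toFun σ := (PiTensorProduct.reindex ℂ (fun _ : Fin n => X) σ).toLinearMap
  map_one' := by ext; simp; rfl
  map_mul' σ τ := by ext; simp; rfl

/-- A representation on `π` of the wreath product of `Σ_n` with `A`, that is, of the algebra
generated by `A^{⊗n}` and `Σ_n` under
`(a_1 ⊗ ⋯ ⊗ a_n) · σ = σ · (a_{σ(1)} ⊗ ⋯ ⊗ a_{σ(n)})`. -/
structure WreathRep (n : ℕ) (A : Type u) [CommRing A] [Algebra ℂ A]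
    (π : Type v) [AddCommGroup π] [Module ℂ π] where
  /-- the action of `A^{⊗n}` -/
  act : (⨂[ℂ] _ : Fin n, A) →ₐ[ℂ] Module.End ℂ π
  /-- the action of `Σ_n` -/
  perm : Representation ℂ (Equiv.Perm (Fin n)) π
  act_perm : ∀ (a : Fin n → A) (σ : Equiv.Perm (Fin n)),
    act (PiTensorProduct.tprod ℂ a) * perm σ =
      perm σ * act (PiTensorProduct.tprod ℂ fun i => a (σ i))

/-! ### The functor `∇` -/

/-- `V^{⊗n}`, where `V = ℂ^r` is the vector representation of `𝔤𝔩_r`. -/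
abbrev VTensor (r n : ℕ) : Type := ⨂[ℂ] _ : Fin n, (Fin r → ℂ)

/-- The operator `u_1 ⊗ ⋯ ⊗ u_n ↦ u_1 ⊗ ⋯ ⊗ x(u_k) ⊗ ⋯ ⊗ u_n` on `V^{⊗n}`, linear in the
matrix `x`. -/
def factorAct (r n : ℕ) (k : Fin n) :
    Matrix (Fin r) (Fin r) ℂ →ₗ[ℂ] Module.End ℂ (VTensor r n) :=
  (PiTensorProduct.mapMultilinear ℂ (fun _ : Fin n => (Fin r → ℂ))
    (fun _ : Fin n => (Fin r → ℂ))).toLinearMap (fun _ => LinearMap.id) k ∘ₗ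
      (Matrix.toLin' : Matrix (Fin r) (Fin r) ℂ ≃ₗ[ℂ] _).toLinearMap

theorem factorAct_tprod (r n : ℕ) (k : Fin n) (x : Matrix (Fin r) (Fin r) ℂ)
    (f : Fin n → Fin r → ℂ) :
    factorAct r n k x (PiTensorProduct.tprod ℂ f) =
      PiTensorProduct.tprod ℂ (Function.update f k (x.mulVec (f k))) := by
  simp only [factorAct, LinearMap.comp_apply, MultilinearMap.toLinearMap_apply,
    LinearEquiv.coe_coe, PiTensorProduct.mapMultilinear_apply, PiTensorProduct.map_tprod]
  congr 1
  ext i : 1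
  by_cases h : i = k
  · subst h; simp [Matrix.toLin'_apply]
  · simp [h]

section Nabla

/-- The additive group structure of the vector space `V^{⊗n} ⊗ π` (definitionally the usual one,
in a form that instance search unifies with `TensorProduct.addCommMonoid`). -/
instance (r n : ℕ) (π : Type v) [AddCommGroup π] [Module ℂ π] :
    AddCommGroup (VTensor r n ⊗[ℂ] π) :=
  Module.addCommMonoidToAddCommGroup ℂ

variable {n : ℕ} {π : Type v} [AddCommGroup π] [Module ℂ π] (ρ : WreathRep n A π)

/-- The action on `V^{⊗n} ⊗ π` of `𝔤 ⊗ A`, for `𝔤 ⊆ 𝔤𝔩_r`: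
`(P ⊗ x)(u_1 ⊗ ⋯ ⊗ u_n ⊗ p) = ∑_k u_1 ⊗ ⋯ ⊗ x(u_k) ⊗ ⋯ ⊗ u_n ⊗ ι_k(P) p`,
where `ι_k : A → A^{⊗n}` is the inclusion as the `k`-th factor. -/
def currentAct (𝔤 : LieSubalgebra ℂ (Matrix (Fin r) (Fin r) ℂ)) :
    A ⊗[ℂ] 𝔤 →ₗ[ℂ] Module.End ℂ (VTensor r n ⊗[ℂ] π) :=
  TensorProduct.lift <| ∑ k : Fin n,
    ((TensorProduct.mapBilinear (RingHom.id ℂ) (VTensor r n) π (VTensor r n) π).flip.compl₁₂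
      (ρ.act.toLinearMap ∘ₗ (PiTensorProduct.singleAlgHom (R := ℂ) (A := fun _ => A) k).toLinearMap)
      (factorAct r n k ∘ₗ 𝔤.toSubmodule.subtype))

theorem currentAct_tmul (𝔤 : LieSubalgebra ℂ (Matrix (Fin r) (Fin r) ℂ)) (P : A) (x : 𝔤) :
    currentAct ρ 𝔤 (P ⊗ₜ[ℂ] x) = ∑ k : Fin n, TensorProduct.map (factorAct r n k x)
      (ρ.act (PiTensorProduct.singleAlgHom (R := ℂ) (A := fun _ => A) k P)) := by
  simp [currentAct, LinearMap.sum_apply]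
  rfl

theorem currentAct_tmul_tmul (𝔤 : LieSubalgebra ℂ (Matrix (Fin r) (Fin r) ℂ)) (P : A) (x : 𝔤)
    (u : Fin n → Fin r → ℂ) (p : π) :
    currentAct ρ 𝔤 (P ⊗ₜ[ℂ] x) (PiTensorProduct.tprod ℂ u ⊗ₜ[ℂ] p) =
      ∑ k : Fin n, PiTensorProduct.tprod ℂ
        (Function.update u k ((x : Matrix (Fin r) (Fin r) ℂ).mulVec (u k))) ⊗ₜ[ℂ]
          ρ.act (PiTensorProduct.singleAlgHom (R := ℂ) (A := fun _ => A) k P) p := by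
  rw [currentAct_tmul, LinearMap.sum_apply]
  simp only [TensorProduct.map_tmul, factorAct_tprod]

theorem factorAct_mul (k : Fin n) (x y : Matrix (Fin r) (Fin r) ℂ) :
    factorAct r n k x * factorAct r n k y = factorAct r n k (x * y) := by
  refine PiTensorProduct.ext (MultilinearMap.ext fun u => ?_)
  simp [factorAct_tprod, Matrix.mulVec_mulVec]

theorem factorAct_comm {k l : Fin n} (h : k ≠ l) (x y : Matrix (Fin r) (Fin r) ℂ) :
    factorAct r n k x * factorAct r n l y = factorAct r n l y * factorAct r n k x := by
  refine PiTensorProduct.ext (MultilinearMap.ext fun u => ?_)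
  simp [factorAct_tprod, Function.update_of_ne h, Function.update_of_ne h.symm,
    Function.update_comm h]

theorem currentAct_lie (𝔤 : LieSubalgebra ℂ (Matrix (Fin r) (Fin r) ℂ)) (z w : A ⊗[ℂ] 𝔤) :
    currentAct ρ 𝔤 ⁅z, w⁆ = ⁅currentAct ρ 𝔤 z, currentAct ρ 𝔤 w⁆ := by
  induction z using TensorProduct.induction_on with
  | zero => simp
  | add z₁ z₂ h₁ h₂ => rw [add_lie, map_add, map_add, add_lie, h₁, h₂]
  | tmul P x =>
    induction w using TensorProduct.induction_on with
    | zero =>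
      have h : ⁅(P ⊗ₜ[ℂ] x : A ⊗[ℂ] 𝔤), (0 : A ⊗[ℂ] 𝔤)⁆ = 0 := by
        have h₀ := LieRing.lie_add (P ⊗ₜ[ℂ] x : A ⊗[ℂ] 𝔤) 0 0
        rwa [add_zero, left_eq_add] at h₀
      rw [h, map_zero, lie_zero]
    | add w₁ w₂ h₁ h₂ =>
      have h : ⁅(P ⊗ₜ[ℂ] x : A ⊗[ℂ] 𝔤), w₁ + w₂⁆ =
        ⁅(P ⊗ₜ[ℂ] x : A ⊗[ℂ] 𝔤), w₁⁆ + ⁅(P ⊗ₜ[ℂ] x : A ⊗[ℂ] 𝔤), w₂⁆ := LieRing.lie_add _ _ _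
      rw [h, map_add, map_add, lie_add, h₁, h₂]
    | tmul Q y =>
      rw [LieAlgebra.ExtendScalars.bracket_tmul, currentAct_tmul, currentAct_tmul,
        currentAct_tmul, Ring.lie_def, Finset.sum_mul_sum, Finset.sum_mul_sum,
        Finset.sum_comm (s := Finset.univ) (t := Finset.univ)
          (f := fun k l => TensorProduct.map (factorAct r n k y) _ *
            TensorProduct.map (factorAct r n l x) _),
        ← Finset.sum_sub_distrib]
      refine Finset.sum_congr rfl fun k _ => ?_
      rw [← Finset.sum_sub_distrib, Finset.sum_eq_single k]
      · rw [← TensorProduct.map_mul, ← TensorProduct.map_mul, factorAct_mul, factorAct_mul,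
          ← map_mul, ← map_mul, ← map_mul, ← map_mul, mul_comm Q P, LieSubalgebra.coe_bracket,
          Ring.lie_def, map_sub]
        ext
        simp [TensorProduct.sub_tmul]
        rfl
      · intro l _ hl
        rw [← TensorProduct.map_mul, ← TensorProduct.map_mul, factorAct_comm hl, ← map_mul,
          ← map_mul, mul_comm, sub_self]
      · simp

/-- `∇_n^r(π) = (V^{⊗n} ⊗ π)^{Σ_n}`, with `Σ_n` acting diagonally. -/
def Nabla (r : ℕ) (ρ : WreathRep n A π) : Type v :=
  ((tensorPerm n (Fin r → ℂ)).tprod ρ.perm).invariants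

instance : AddCommGroup (Nabla r ρ) :=
  inferInstanceAs (AddCommGroup ((tensorPerm n (Fin r → ℂ)).tprod ρ.perm).invariants)

instance : Module ℂ (Nabla r ρ) :=
  inferInstanceAs (Module ℂ ((tensorPerm n (Fin r → ℂ)).tprod ρ.perm).invariants)

theorem currentAct_perm (𝔤 : LieSubalgebra ℂ (Matrix (Fin r) (Fin r) ℂ)) (z : A ⊗[ℂ] 𝔤)
    (σ : Equiv.Perm (Fin n)) :
    currentAct ρ 𝔤 z * (tensorPerm n (Fin r → ℂ)).tprod ρ.perm σ =
      (tensorPerm n (Fin r → ℂ)).tprod ρ.perm σ * currentAct ρ 𝔤 z := by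
  induction z using TensorProduct.induction_on with
  | zero => simp
  | add z₁ z₂ h₁ h₂ => rw [map_add, add_mul, mul_add, h₁, h₂]
  | tmul P x =>
    rw [currentAct_tmul, Representation.tprod_apply, Finset.sum_mul, Finset.mul_sum,
      ← Equiv.sum_comp σ]
    refine Finset.sum_congr rfl fun k _ => ?_
    rw [← TensorProduct.map_mul, ← TensorProduct.map_mul]
    congr 1
    · refine PiTensorProduct.ext (MultilinearMap.ext fun u => ?_)
      simp only [tensorPerm, LinearMap.compMultilinearMap_apply, Module.End.mul_apply,
        MonoidHom.coe_mk, OneHom.coe_mk, LinearEquiv.coe_coe, PiTensorProduct.reindex_tprod,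
        factorAct_tprod]
      congr 1
      ext i : 1
      by_cases h : i = σ k
      · subst h; simp
      · have h' : σ.symm i ≠ k := fun e => h (by rw [← e]; simp)
        simp [h, h']
    · rw [PiTensorProduct.singleAlgHom_apply, ρ.act_perm, PiTensorProduct.singleAlgHom_apply]
      congr 3
      ext i
      by_cases h : i = k
      · subst h; simp
      · simp [h]

/-- The representation of `𝔤 ⊗ A` on `∇_n^r(π)`, restricted from `V^{⊗n} ⊗ π`. -/
def nablaAct (𝔤 : LieSubalgebra ℂ (Matrix (Fin r) (Fin r) ℂ)) :
    A ⊗[ℂ] 𝔤 →ₗ⁅ℂ⁆ Module.End ℂ (Nabla r ρ) where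
  toFun z := (currentAct ρ 𝔤 z).restrict
    (p := ((tensorPerm n (Fin r → ℂ)).tprod ρ.perm).invariants)
    (q := ((tensorPerm n (Fin r → ℂ)).tprod ρ.perm).invariants) fun t ht σ => by
      have h := LinearMap.congr_fun (currentAct_perm ρ 𝔤 z σ) t
      rw [Module.End.mul_apply, Module.End.mul_apply, ht σ] at h
      exact h.symm
  map_add' z w := by
    refine LinearMap.ext fun t => Subtype.ext ?_
    exact LinearMap.congr_fun (map_add (currentAct ρ 𝔤) z w) t.1
  map_smul' c z := by
    refine LinearMap.ext fun t => Subtype.ext ?_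
    exact LinearMap.congr_fun (map_smul (currentAct ρ 𝔤) c z) t.1
  map_lie' {z w} := by
    refine LinearMap.ext fun t => Subtype.ext ?_
    exact LinearMap.congr_fun (currentAct_lie ρ 𝔤 z w) t.1

instance (𝔤 : LieSubalgebra ℂ (Matrix (Fin r) (Fin r) ℂ)) :
    LieRingModule (A ⊗[ℂ] 𝔤) (Nabla r ρ) :=
  LieRingModule.compLieHom _ (nablaAct ρ 𝔤)

instance (𝔤 : LieSubalgebra ℂ (Matrix (Fin r) (Fin r) ℂ)) :
    LieModule ℂ (A ⊗[ℂ] 𝔤) (Nabla r ρ) :=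
  LieModule.compLieHom _ (nablaAct ρ 𝔤)

end Nabla

/-! ### Diagonal harmonics -/

section DiagonalHarmonics

variable (n : ℕ) (ε : A →ₐ[ℂ] ℂ)

/-- The augmentation `a_1 ⊗ ⋯ ⊗ a_n ↦ ε(a_1) ⋯ ε(a_n)` of `A^{⊗n}`. -/
def tensorAug : (⨂[ℂ] _ : Fin n, A) →ₐ[ℂ] ℂ :=
  PiTensorProduct.liftAlgHom
    ((MultilinearMap.mkPiAlgebra ℂ (Fin n) ℂ).compLinearMap fun _ => ε.toLinearMap)
    (by simp) (by simp [Finset.prod_mul_distrib])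

/-- `S^n(A)_ε`: the elements of `S^n(A) = (A^{⊗n})^{Σ_n}` in the kernel of the augmentation. -/
def symAugmentation : Set (⨂[ℂ] _ : Fin n, A) :=
  {s | s ∈ (tensorPerm n A).invariants ∧ tensorAug n ε s = 0}

/-- The ideal `S^n(A)_ε · A^{⊗n}` of `A^{⊗n}`. -/
def harmonicIdeal : Ideal (⨂[ℂ] _ : Fin n, A) := Ideal.span (symAugmentation n ε)

/-- The space of diagonal harmonics `DH_n(A) = A^{⊗n} / S^n(A)_ε · A^{⊗n}`. -/
abbrev DH : Type u := (⨂[ℂ] _ : Fin n, A) ⧸ harmonicIdeal n ε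

theorem tensorPerm_mul (σ : Equiv.Perm (Fin n)) (s t : ⨂[ℂ] _ : Fin n, A) :
    tensorPerm n A σ (s * t) = tensorPerm n A σ s * tensorPerm n A σ t := by
  induction s using PiTensorProduct.induction_on with
  | add s₁ s₂ h₁ h₂ => rw [add_mul, map_add, map_add, add_mul, h₁, h₂]
  | smul_tprod c a =>
    induction t using PiTensorProduct.induction_on with
    | add t₁ t₂ h₁ h₂ => rw [mul_add, map_add, map_add, mul_add, h₁, h₂]
    | smul_tprod d b =>
      rw [PiTensorProduct.smul_tprod_mul_smul_tprod, map_smul, map_smul, map_smul]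
      simp only [tensorPerm, MonoidHom.coe_mk, OneHom.coe_mk, LinearEquiv.coe_coe,
        PiTensorProduct.reindex_tprod, PiTensorProduct.smul_tprod_mul_smul_tprod]
      rfl

/-- The permutation action of `σ` on `A^{⊗n}` as an algebra homomorphism. -/
def tensorPermAlgHom (A : Type u) [CommRing A] [Algebra ℂ A] (σ : Equiv.Perm (Fin n)) :
    (⨂[ℂ] _ : Fin n, A) →ₐ[ℂ] (⨂[ℂ] _ : Fin n, A) :=
  AlgHom.ofLinearMap (tensorPerm n A σ) (PiTensorProduct.reindex_tprod σ _) (tensorPerm_mul n σ)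

theorem harmonicIdeal_le_comap (σ : Equiv.Perm (Fin n)) :
    harmonicIdeal n ε ≤ (harmonicIdeal n ε).comap (tensorPermAlgHom n A σ) := by
  refine Ideal.span_le.2 fun s hs => ?_
  have h : tensorPermAlgHom n A σ s = s := hs.1 σ
  rw [SetLike.mem_coe, Ideal.mem_comap, h]
  exact Ideal.subset_span hs

/-- The action of `Σ_n` on `DH_n(A)` induced by the permutation of factors of `A^{⊗n}`. -/
def dhPerm : Representation ℂ (Equiv.Perm (Fin n)) (DH n ε) where
  toFun σ := (Ideal.quotientMapₐ (harmonicIdeal n ε) (tensorPermAlgHom n A σ)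
    (harmonicIdeal_le_comap n ε σ)).toLinearMap
  map_one' := by
    refine LinearMap.ext fun q => ?_
    obtain ⟨t, rfl⟩ := Ideal.Quotient.mk_surjective q
    exact congrArg (Ideal.Quotient.mk (harmonicIdeal n ε))
      (LinearMap.congr_fun (map_one (tensorPerm n A)) t)
  map_mul' σ τ := by
    refine LinearMap.ext fun q => ?_
    obtain ⟨t, rfl⟩ := Ideal.Quotient.mk_surjective q
    exact congrArg (Ideal.Quotient.mk (harmonicIdeal n ε))
      (LinearMap.congr_fun (map_mul (tensorPerm n A) σ τ) t)

/-- `DH_n(A)` as a representation of the wreath product: `A^{⊗n}` acts by multiplication and `Σ_n`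
by permutation of factors. -/
def dhRep : WreathRep n A (DH n ε) where
  act := Algebra.lsmul ℂ ℂ (DH n ε)
  perm := dhPerm n ε
  act_perm a σ := by
    refine LinearMap.ext fun q => ?_
    obtain ⟨t, rfl⟩ := Ideal.Quotient.mk_surjective q
    refine congrArg (Ideal.Quotient.mk (harmonicIdeal n ε)) (?_ :
      PiTensorProduct.tprod ℂ a * tensorPerm n A σ t =
        tensorPerm n A σ (PiTensorProduct.tprod ℂ (fun i => a (σ i)) * t))
    rw [tensorPerm_mul]
    congr 1
    simp [tensorPerm]

end DiagonalHarmonics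

end WeylDuality

end

/-! The module `Nabla r (dhRep n ε)` is shown to have the universal property directly; the Weyl
module, a quotient of the enveloping algebra, is then identified with it. Matrix indices start at 0,
so the highest weight vector of V is e_0.

The tool is the normally ordered product :b_1 ⋯ b_k: applied to a vector y. On a space with n
commuting places it is the sum, over all ways of putting b_1, …, b_k at distinct places, of the
resulting operators (`normalProd_eq_sum_places`). Its recursive definition only uses the Lie action
β together with the associative product of B = 𝔤𝔩_r ⊗ A, so it makes sense in every module.

Let y generate a finite-dimensional highest weight module N. After extending the action to 𝔤𝔩_r ⊗ A
(`extendedAct`), all E_{ij} with j ≠ 0 kill y, and finite dimension forces every product of length n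
+ 1 on y to vanish (`normalProd_eq_zero`), just as if there were only n places. Hence sending u ⊗ p
to :(u_1 ⊗ p_1) ⋯ (u_n ⊗ p_n): y, with u_j placed in the first column of a matrix, is equivariant
(`apply_symbolMap`). Applying it to (Q ⊗ E_{00}) y = n ε(Q) y shows that power sums act through the
augmentation. They generate S^n(A) (`mem_of_mem_invariants`), so the map factors through DH_n(A).
Restricted to invariants and divided by n!, it sends e_0^{⊗n} ⊗ 1 to y.

Conversely, DH_n(A) is finite-dimensional because each ι_k(Q) is integral over the symmetric
tensors, and e_0^{⊗n} ⊗ 1 generates the invariants because symmetrised tensors are normally ordered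
products on it (`sum_tprod_perm_tmul`). Finally the annihilator of a universal generator is
`weylIdeal` (`mem_weylIdeal_iff`). -/

noncomputable section

namespace WeylDuality

/-! ### Normally ordered products -/

section NormalProd

variable {B : Type*} [Ring B] [Algebra ℂ B] {N : Type*} [AddCommGroup N] [Module ℂ N]

/-- The operator on multilinear maps which sums over all places the precomposition at that place
with the left multiplication by an element of `B`. -/
def leftMulSum (k : ℕ) :
    MultilinearMap ℂ (fun _ : Fin k => B) N →ₗ[ℂ] B →ₗ[ℂ] MultilinearMap ℂ (fun _ : Fin k => B) N :=
  LinearMap.flip <| ∑ j : Fin k,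
    (MultilinearMap.compLinearMapMultilinear (R := ℂ) (M₁ := fun _ : Fin k => B)
      (M₁' := fun _ : Fin k => B) (M₂ := N)).toLinearMap (fun _ => LinearMap.id) j ∘ₗ
        LinearMap.mul ℂ B

theorem leftMulSum_apply {k : ℕ} (f : MultilinearMap ℂ (fun _ : Fin k => B) N) (c : B)
    (b : Fin k → B) : leftMulSum k f c b = ∑ j, f (Function.update b j (c * b j)) := by
  simp only [leftMulSum, LinearMap.flip_apply, LinearMap.sum_apply, sum_apply,
    LinearMap.comp_apply, MultilinearMap.toLinearMap_apply,
    MultilinearMap.compLinearMapMultilinear_apply]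
  refine Finset.sum_congr rfl fun j _ => congrArg f (funext fun i => ?_)
  by_cases h : i = j
  · subst h; simp
  · simp [h]

/-- The normally ordered product `:b_1 ⋯ b_k:` of elements of an associative algebra `B` acting
through `β` on a vector `y`; it is determined by
`c · :b_1 ⋯ b_k: = :c b_1 ⋯ b_k: + ∑_j :b_1 ⋯ (c b_j) ⋯ b_k:`. -/
def normalProd (β : B →ₗ[ℂ] Module.End ℂ N) (y : N) :
    (k : ℕ) → MultilinearMap ℂ (fun _ : Fin k => B) N
  | 0 => MultilinearMap.constOfIsEmpty ℂ _ y
  | k + 1 => LinearMap.uncurryLeft (M := fun _ : Fin (k + 1) => B)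
      ({ toFun := fun c => (β c).compMultilinearMap (normalProd β y k)
         map_add' := fun c d => by rw [map_add, LinearMap.add_compMultilinearMap]
         map_smul' := fun a c => by rw [map_smul, LinearMap.smul_compMultilinearMap]; rfl } -
        leftMulSum k (normalProd β y k))

variable (β : B →ₗ[ℂ] Module.End ℂ N) (y : N)

theorem normalProd_zero (b : Fin 0 → B) : normalProd β y 0 b = y := rfl

theorem normalProd_cons {k : ℕ} (c : B) (b : Fin k → B) :
    normalProd β y (k + 1) (Fin.cons c b : Fin (k + 1) → B) =
      β c (normalProd β y k b) - ∑ j, normalProd β y k (Function.update b j (c * b j)) := by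
  rw [← leftMulSum_apply]
  simp [normalProd]

theorem apply_normalProd {k : ℕ} (c : B) (b : Fin k → B) :
    β c (normalProd β y k b) = normalProd β y (k + 1) (Fin.cons c b : Fin (k + 1) → B) +
      ∑ j, normalProd β y k (Function.update b j (c * b j)) := by
  rw [normalProd_cons, sub_add_cancel]

/-! ### Symmetry and vanishing of normally ordered products for a Lie action. -/

section Lie

variable {β} (hβ : ∀ c d : B, β (c * d - d * c) = β c * β d - β d * β c)
include hβ

/-- Expanding both outer factors leaves β(c)β(d) - β(cd), symmetric in c and d because β respects
commutators, and terms in which c and d are absorbed into the b_j. The latter are symmetric once the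
contributions where both hit the same b_j are set against the term with cd. -/
theorem normalProd_cons_cons_comm {k : ℕ} (c d : B) (b : Fin k → B) :
    normalProd β y (k + 2) (Fin.cons c (Fin.cons d b : Fin (k + 1) → B) : Fin (k + 2) → B) =
      normalProd β y (k + 2)
        (Fin.cons d (Fin.cons c b : Fin (k + 1) → B) : Fin (k + 2) → B) := by
  have key : ∀ c d : B,
      normalProd β y (k + 2) (Fin.cons c (Fin.cons d b : Fin (k + 1) → B) : Fin (k + 2) → B) =
      β c (β d (normalProd β y k b)) - β (c * d) (normalProd β y k b)
        + (∑ j, normalProd β y k (Function.update b j (c * d * b j)))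
        - (∑ j, β c (normalProd β y k (Function.update b j (d * b j))))
        - (∑ j, β d (normalProd β y k (Function.update b j (c * b j))))
        + ∑ j, ∑ l, normalProd β y k (Function.update (Function.update b j (c * b j)) l
            (d * Function.update b j (c * b j) l)) := by
    intro c d
    rw [normalProd_cons, normalProd_cons, Fin.sum_univ_succ]
    simp only [Fin.cons_zero, Fin.cons_succ, Fin.update_cons_zero, ← Fin.cons_update,
      normalProd_cons, map_sub, map_sum, Finset.sum_sub_distrib, mul_assoc]
    abel
  -- Removing the diagonal l = j from the double sum leaves c and d acting on different entries,
  -- where their order is irrelevant.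
  have hsym : ∑ j, ∑ l, normalProd β y k (Function.update (Function.update b j (c * b j)) l
            (d * Function.update b j (c * b j) l))
          - ∑ j, normalProd β y k (Function.update b j (d * c * b j)) =
      ∑ j, ∑ l, normalProd β y k (Function.update (Function.update b j (d * b j)) l
            (c * Function.update b j (d * b j) l))
          - ∑ j, normalProd β y k (Function.update b j (c * d * b j)) := by
    rw [← Finset.sum_sub_distrib, ← Finset.sum_sub_distrib]
    have h : ∀ c d : B, ∀ j, ∑ l, normalProd β y k
        (Function.update (Function.update b j (c * b j)) l
          (d * Function.update b j (c * b j) l)) -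
        normalProd β y k (Function.update b j (d * c * b j)) =
        ∑ l, if l = j then 0 else normalProd β y k
          (Function.update (Function.update b j (c * b j)) l (d * b l)) := by
      intro c d j
      rw [← Finset.add_sum_erase _ _ (Finset.mem_univ j), ← Finset.add_sum_erase (a := j)
        _ (fun l => if l = j then (0 : N) else _) (Finset.mem_univ j)]
      simp only [Function.update_self, Function.update_idem, mul_assoc, if_true, zero_add,
        add_sub_cancel_left]
      refine Finset.sum_congr rfl fun l hl => ?_
      have hl' := Finset.ne_of_mem_erase hl
      rw [if_neg hl', Function.update_of_ne hl']
    simp only [h]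
    rw [Finset.sum_comm]
    refine Finset.sum_congr rfl fun j _ => Finset.sum_congr rfl fun l _ => ?_
    by_cases hl : l = j
    · simp [hl]
    · rw [if_neg hl, if_neg (Ne.symm hl), Function.update_comm hl]
  have hb := LinearMap.congr_fun (hβ c d) (normalProd β y k b)
  simp only [map_sub, LinearMap.sub_apply, Module.End.mul_apply] at hb
  rw [key, key]
  rw [sub_eq_sub_iff_add_eq_add] at hb hsym
  rw [← sub_eq_zero] at hb hsym ⊢
  calc _ = _ := ?_
    _ = (0 : N) + 0 := congrArg₂ (· + ·) (neg_eq_zero.2 hb) hsym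
    _ = 0 := add_zero 0
  abel

theorem normalProd_comp_perm {k : ℕ} (b : Fin k → B) (σ : Equiv.Perm (Fin k)) :
    normalProd β y k (b ∘ σ) = normalProd β y k b := by
  induction k with
  | zero => congr 1; exact Subsingleton.elim _ _
  | succ k ih =>
    -- Adjacent transpositions suffice: the first one is the swap of the two outer factors, and the
    -- others act on the tail, where the inductive hypothesis applies.
    have hσ : σ ∈ Submonoid.closure
        (Set.range fun i : Fin k => Equiv.swap i.castSucc i.succ) := by
      rw [Equiv.Perm.mclosure_swap_castSucc_succ]; trivial
    induction hσ using Submonoid.closure_induction generalizing b with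
    | one => rfl
    | mul σ τ _ _ hσ hτ =>
      rw [Equiv.Perm.coe_mul, ← Function.comp_assoc, hτ, hσ]
    | mem σ hσ =>
      obtain ⟨i, rfl⟩ := hσ
      obtain _ | k := k
      · exact i.elim0
      · induction i using Fin.cases with
        | zero =>
          rw [← Fin.cons_self_tail b, ← Fin.cons_self_tail (Fin.tail b),
            normalProd_cons_cons_comm y hβ]
          congr 1
          ext l
          induction l using Fin.cases with
          | zero => simp; rfl
          | succ l =>
            induction l using Fin.cases with
            | zero => simp
            | succ l =>
              simp [Equiv.swap_apply_of_ne_of_ne, Fin.ext_iff]; rfl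
        | succ i =>
          have h : b ∘ (Equiv.swap i.succ.castSucc i.succ.succ) =
              (Fin.cons (b 0) (Fin.tail b ∘ Equiv.swap i.castSucc i.succ) :
                Fin (k + 2) → B) := by
            ext l
            induction l using Fin.cases with
            | zero => simp [Equiv.swap_apply_of_ne_of_ne, Fin.ext_iff]
            | succ l =>
              simp only [Function.comp_apply, Fin.cons_succ, Fin.tail]
              congr 1
              simp only [← Fin.succ_castSucc]
              exact ((Fin.succ_injective (k + 1)).swap_apply i.castSucc i.succ l)
          rw [h]
          conv_rhs => rw [← Fin.cons_self_tail b]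
          rw [normalProd_cons, normalProd_cons, ih]
          congr 1
          rw [← Equiv.sum_comp (Equiv.swap i.castSucc i.succ)
            (fun j => normalProd β y _ (Function.update (Fin.tail b) j _))]
          refine Finset.sum_congr rfl fun j _ => ?_
          rw [← ih (Function.update (Fin.tail b) _ _) (Equiv.swap i.castSucc i.succ),
            Function.update_comp_eq_of_injective _ (Equiv.injective _)]
          rfl

/-- The counterpart of `apply_normalProd` for an operator acting first: with d at a place of its own
it is one more factor, and at the place of b_j it multiplies b_j on the right. -/
theorem normalProd_apply {k : ℕ} (d : B) (b : Fin k → B) :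
    normalProd β (β d y) k b = normalProd β y (k + 1) (Fin.cons d b : Fin (k + 1) → B) +
      ∑ j, normalProd β y k (Function.update b j (b j * d)) := by
  induction k with
  | zero => simp [normalProd_cons, normalProd_zero]
  | succ k ih =>
    rw [← Fin.cons_self_tail b]
    generalize b 0 = c
    generalize Fin.tail b = b
    rw [normalProd_cons_cons_comm y hβ, normalProd_cons, normalProd_cons _ _ c, ih,
      Fin.sum_univ_succ, Fin.sum_univ_succ]
    simp only [Fin.cons_zero, Fin.cons_succ, Fin.update_cons_zero, ← Fin.cons_update,
      normalProd_cons β y c, ih, map_add, map_sum, Finset.sum_add_distrib,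
      Finset.sum_sub_distrib]
    have h : ∑ j, ∑ l, normalProd β y k (Function.update (Function.update b j (c * b j)) l
            (Function.update b j (c * b j) l * d)) =
        ∑ j, ∑ l, normalProd β y k (Function.update (Function.update b j (b j * d)) l
            (c * Function.update b j (b j * d) l)) := by
      rw [Finset.sum_comm]
      refine Finset.sum_congr rfl fun j _ => Finset.sum_congr rfl fun l _ => ?_
      by_cases hl : l = j
      · subst hl; simp [mul_assoc]
      · rw [Function.update_of_ne hl, Function.update_of_ne (Ne.symm hl),
          Function.update_comm hl]
    rw [h]
    abel

/-- Left multiplications in the recursion keep an entry inside q, so an entry of q in the tail is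
handled by induction. At the head it is first moved inwards by symmetry, unless it is the only
factor and kills y itself. -/
theorem normalProd_eq_zero_of_mem (q : Set B) (hq : ∀ c : B, ∀ x ∈ q, c * x ∈ q)
    (hy : ∀ x ∈ q, β x y = 0) {k : ℕ} (b : Fin k → B) (j : Fin k) (hj : b j ∈ q) :
    normalProd β y k b = 0 := by
  induction k with
  | zero => exact j.elim0
  | succ k ih =>
    have htail : ∀ (c : B) (b : Fin k → B) (j : Fin k), b j ∈ q →
        normalProd β y (k + 1) (Fin.cons c b : Fin (k + 1) → B) = 0 := by
      intro c b j hj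
      rw [normalProd_cons, ih b j hj, map_zero, zero_sub, neg_eq_zero]
      refine Finset.sum_eq_zero fun l _ => ih _ j ?_
      by_cases h : j = l
      · subst h; simpa using hq c _ hj
      · simpa [h] using hj
    rw [← Fin.cons_self_tail b]
    induction j using Fin.cases with
    | succ j => exact htail _ _ j hj
    | zero =>
      obtain _ | k := k
      · rw [normalProd_cons, normalProd_zero, hy _ hj]; simp
      · rw [← Fin.cons_self_tail (Fin.tail b), normalProd_cons_cons_comm y hβ]
        exact htail _ _ 0 (by simpa using hj)

omit hβ in
-- Adding the factor 1 to a product of length l multiplies it by n - l, so vanishing descends from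
-- length l + 1 to length l as long as n ≠ l.
theorem normalProd_eq_zero_of_le (n : ℂ) (h1 : ∀ m, β 1 m = n • m) {k K : ℕ} (hkK : k ≤ K)
    (hk : ∀ l : ℕ, k ≤ l → n ≠ l) (hK : normalProd β y K = 0) : normalProd β y k = 0 := by
  refine Nat.decreasingInduction' (P := fun k => normalProd β y k = 0) (m := k) (n := K)
    (fun l _ hl h => ?_) hkK hK
  ext b
  have e := apply_normalProd β y 1 b
  rw [h1, h] at e
  simp only [one_mul, Function.update_eq_self, zero_apply, zero_add,
    Finset.sum_const, Finset.card_univ, Fintype.card_fin, ← Nat.cast_smul_eq_nsmul ℂ] at e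
  rw [← sub_eq_zero, ← sub_smul] at e
  exact (smul_eq_zero.1 e).resolve_left (sub_ne_zero.2 (hk l hl))

end Lie

/-! ### Normally ordered products for a sum of commuting actions. -/

section Places

variable {n : ℕ} (ι : Fin n → B →ₐ[ℂ] Module.End ℂ N)
  (hι : ∀ i j, i ≠ j → ∀ c d, Commute (ι i c) (ι j d))
include hι

theorem place_mul_prod {k : ℕ} (τ : Fin k → Fin n) (hτ : Function.Injective τ) (b : Fin k → B)
    (j : Fin k) (c : B) :
    ι (τ j) c * (List.ofFn fun l => ι (τ l) (b l)).prod =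
      (List.ofFn fun l => ι (τ l) (Function.update b j (c * b j) l)).prod := by
  induction k with
  | zero => exact j.elim0
  | succ k ih =>
    rw [List.ofFn_succ, List.ofFn_succ, List.prod_cons, List.prod_cons]
    induction j using Fin.cases with
    | zero => simp [mul_assoc]
    | succ j =>
      have h0 : τ j.succ ≠ τ 0 := fun h => Fin.succ_ne_zero j (hτ h)
      rw [← mul_assoc, (hι _ _ h0 _ _).eq, mul_assoc,
        ih (fun l => τ l.succ) (hτ.comp (Fin.succ_injective k)) (fun l => b l.succ) j]
      congr 2
      congr 1
      ext l : 1
      congr 1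
      by_cases h : l = j
      · subst h; simp
      · simp [h]

variable {β}

theorem normalProd_eq_sum_places (hβ : ∀ c, β c = ∑ i, ι i c) {k : ℕ} (b : Fin k → B) :
    normalProd β y k b = ∑ τ : Fin k → Fin n with Function.Injective τ,
      (List.ofFn fun l => ι (τ l) (b l)).prod y := by
  induction k with
  | zero => simp [normalProd_zero, Function.injective_of_subsingleton]
  | succ k ih =>
    rw [← Fin.cons_self_tail b]
    generalize b 0 = c
    generalize Fin.tail b = b
    rw [normalProd_cons, ih, Finset.sum_filter (s := Finset.univ (α := Fin (k + 1) → Fin n)),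
      ← (Fin.consEquiv fun _ : Fin (k + 1) => Fin n).sum_comp, Fintype.sum_prod_type_right]
    simp only [ih]
    rw [Finset.sum_comm (s := Finset.univ (α := Fin k)), map_sum, ← Finset.sum_sub_distrib,
      Finset.sum_filter]
    refine Finset.sum_congr rfl fun τ _ => ?_
    by_cases hτ : Function.Injective τ
    swap
    · rw [if_neg hτ, Finset.sum_eq_zero]
      intro i _
      rw [if_neg]
      intro h
      exact hτ (Fin.cons_injective_iff.1 h).2
    rw [if_pos hτ]
    have hP : ∀ j, (List.ofFn fun l => ι (τ l) (Function.update b j (c * b j) l)).prod y =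
        ι (τ j) c ((List.ofFn fun l => ι (τ l) (b l)).prod y) := fun j => by
      rw [← place_mul_prod ι hι τ hτ b j c]; rfl
    simp only [hP]
    -- The subtracted terms are those where c sits at a place already used by τ; what remains are
    -- the places that extend τ injectively.
    rw [hβ, LinearMap.sum_apply, ← Finset.sum_image (s := Finset.univ (α := Fin k)) (g := τ)
      (f := fun i => ι i c ((List.ofFn fun l => ι (τ l) (b l)).prod y)) (hτ.injOn),
      ← Finset.sum_sdiff (Finset.subset_univ (Finset.univ.image τ)), add_sub_cancel_right,
      ← Finset.sum_filter]
    refine Finset.sum_congr ?_ fun i _ => ?_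
    · ext i
      simp [Fin.consEquiv, Fin.cons_injective_iff, hτ]
    · simp [Fin.consEquiv, List.ofFn_succ]

end Places

end NormalProd

/-! ### Vanishing of long normally ordered products -/

section Matrices

variable {r : ℕ} {A : Type u} [CommRing A] [Algebra ℂ A]

/-- The matrix unit `E_{ij}` with coefficient `P`. -/
def unit (P : A) (i j : Fin r) : A ⊗[ℂ] Matrix (Fin r) (Fin r) ℂ :=
  P ⊗ₜ[ℂ] Matrix.single i j 1

theorem unit_mul_unit (P Q : A) (i j k l : Fin r) :
    unit P i j * unit Q k l = if j = k then unit (P * Q) i l else 0 := by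
  rw [unit, unit, Algebra.TensorProduct.tmul_mul_tmul]
  split_ifs with h
  · subst h
    rw [Matrix.single_mul_single_same, mul_one, unit]
  · rw [Matrix.single_mul_single_of_ne _ _ _ _ h, TensorProduct.tmul_zero]

theorem tmul_eq_sum_unit (P : A) (x : Matrix (Fin r) (Fin r) ℂ) :
    P ⊗ₜ[ℂ] x = ∑ i, ∑ j, x i j • unit P i j := by
  conv_lhs => rw [Matrix.matrix_eq_sum_single x]
  simp only [TensorProduct.tmul_sum, unit, ← TensorProduct.tmul_smul, Matrix.smul_single,
    smul_eq_mul, mul_one]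

theorem linearMap_ext_unit {N : Type*} [AddCommGroup N] [Module ℂ N]
    {f g : A ⊗[ℂ] Matrix (Fin r) (Fin r) ℂ →ₗ[ℂ] N}
    (h : ∀ P i j, f (unit P i j) = g (unit P i j)) : f = g := by
  refine TensorProduct.ext' fun P x => ?_
  simp only [tmul_eq_sum_unit, map_sum, map_smul, h]

theorem multilinearMap_ext_unit {N : Type*} [AddCommGroup N] [Module ℂ N] {k : ℕ}
    {f g : MultilinearMap ℂ (fun _ : Fin k => A ⊗[ℂ] Matrix (Fin r) (Fin r) ℂ) N}
    (h : ∀ (P : Fin k → A) (i j : Fin k → Fin r),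
      f (fun l => unit (P l) (i l) (j l)) = g (fun l => unit (P l) (i l) (j l))) : f = g := by
  refine Module.Basis.ext_multilinear
    (fun _ => (Module.Free.chooseBasis ℂ A).tensorProduct (Matrix.stdBasis ℂ (Fin r) (Fin r)))
    fun v => ?_
  convert h (fun l => Module.Free.chooseBasis ℂ A (v l).1) (fun l => (v l).2.1)
    (fun l => (v l).2.2) using 3 <;>
  exact (Module.Basis.tensorProduct_apply' _ _ _).trans
    (congrArg _ (Matrix.stdBasis_eq_single ℂ _ _))

variable [NeZero r] {N : Type*} [AddCommGroup N] [Module ℂ N]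
  {β : A ⊗[ℂ] Matrix (Fin r) (Fin r) ℂ →ₗ[ℂ] Module.End ℂ N}
  (hβ : ∀ c d, β (c * d - d * c) = β c * β d - β d * β c) {y : N}
  (hy : ∀ (P : A) (i j : Fin r), j ≠ 0 → β (unit P i j) y = 0)

include hy in
-- Right multiplication by E_{00} projects onto the first column, so its kernel is the left ideal of
-- matrices supported in the other columns.
theorem apply_eq_zero_of_mul_eq_zero (x : A ⊗[ℂ] Matrix (Fin r) (Fin r) ℂ)
    (hx : x * unit 1 0 0 = 0) : β x y = 0 := by
  have h : (LinearMap.applyₗ y ∘ₗ β) ∘ₗ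
      (LinearMap.id - LinearMap.mulRight ℂ (unit (1 : A) (0 : Fin r) 0)) = 0 := by
    refine linearMap_ext_unit fun P i j => ?_
    by_cases hj : j = 0
    · subst hj
      simp [unit_mul_unit]
    · simp [unit_mul_unit, hj, hy]
  simpa [hx] using LinearMap.congr_fun h x

include hβ hy

theorem normalProd_unit_eq_zero {k : ℕ} (b : Fin k → A ⊗[ℂ] Matrix (Fin r) (Fin r) ℂ)
    (j : Fin k) (hj : b j * unit 1 0 0 = 0) : normalProd β y k b = 0 :=
  normalProd_eq_zero_of_mem y hβ {x | x * unit 1 0 0 = 0}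
    (fun c x (hx : x * _ = 0) => show c * x * _ = 0 by rw [mul_assoc, hx, mul_zero])
    (apply_eq_zero_of_mul_eq_zero hy) b j hj

/-- The element e = 1 - E_{00} fixes each E_{i0} with i ≠ 0 and satisfies e E_{00} = 0. Hence such a
product of length k is zero or an eigenvector of β(e) with eigenvalue k, and in finite dimension
only finitely many k are eigenvalues. The same k serves for all P and i. -/
theorem exists_normalProd_lower_eq_zero [Module.Finite ℂ N] (n : ℕ) :
    ∃ k, n < k ∧ ∀ (P : Fin k → A) (i : Fin k → Fin r), (∀ j, i j ≠ 0) →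
      normalProd β y k (fun j => unit (P j) (i j) 0) = 0 := by
  set e : A ⊗[ℂ] Matrix (Fin r) (Fin r) ℂ := 1 - unit 1 0 0
  have hfin : Set.Finite {k : ℕ | (β e).HasEigenvalue (k : ℂ)} :=
    (Module.End.finite_hasEigenvalue (β e)).preimage Nat.cast_injective.injOn
  obtain ⟨k, hk⟩ := (hfin.union (Set.finite_Iic n)).exists_notMem
  rw [Set.mem_union, not_or] at hk
  refine ⟨k, not_le.1 hk.2, fun P i hi => ?_⟩
  by_contra hne
  refine hk.1 (Module.End.hasEigenvalue_of_hasEigenvector (x := normalProd β y k _)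
    ⟨Module.End.mem_eigenspace_iff.2 ?_, hne⟩)
  rw [apply_normalProd, normalProd_unit_eq_zero hβ hy _ 0
    (by simp [e, sub_mul, unit_mul_unit]), zero_add]
  have h : ∀ j, e * unit (P j) (i j) 0 = unit (P j) (i j) 0 := fun j => by
    simp [e, sub_mul, unit_mul_unit, (hi j).symm]
  simp only [h, Function.update_eq_self, Finset.sum_const, Finset.card_univ, Fintype.card_fin,
    Nat.cast_smul_eq_nsmul]

-- Double induction: on the number of entries in row 0, then on the number of entries other than 1 ⊗
-- E_{i₀0}. An entry P ⊗ E_{00} is recovered by letting P ⊗ E_{0i₀} act on the product in which it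
-- is replaced by 1 ⊗ E_{i₀0}, which vanishes because it has fewer entries in row 0.
open Classical in
theorem normalProd_column_eq_zero {k : ℕ} {i₀ : Fin r} (hi₀ : i₀ ≠ 0)
    (hlow : ∀ (P : Fin k → A) (i : Fin k → Fin r), (∀ j, i j ≠ 0) →
      normalProd β y k (fun j => unit (P j) (i j) 0) = 0) (m c : ℕ) (P : Fin k → A)
    (i : Fin k → Fin r) (hm : (Finset.univ.filter fun j => i j = 0).card ≤ m)
    (hc : (Finset.univ.filter fun j => ¬ (i j = i₀ ∧ P j = 1)).card ≤ c) :
    normalProd β y k (fun j => unit (P j) (i j) 0) = 0 := by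
  induction m generalizing c P i with
  | zero =>
    refine hlow P i fun j hj => ?_
    rw [Nat.le_zero, Finset.card_eq_zero] at hm
    exact Finset.notMem_empty j (hm ▸ Finset.mem_filter.2 ⟨Finset.mem_univ j, hj⟩)
  | succ m ihm =>
  induction c generalizing P i with
  | zero =>
    refine hlow P i fun j hj => ?_
    rw [Nat.le_zero, Finset.card_eq_zero] at hc
    refine Finset.notMem_empty j (hc ▸ Finset.mem_filter.2 ⟨Finset.mem_univ j, fun h => ?_⟩)
    exact hi₀ (h.1.symm.trans hj)
  | succ c ihc =>
  by_cases h0 : ∀ j, i j ≠ 0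
  · exact hlow P i h0
  push Not at h0
  obtain ⟨j₀, hj₀⟩ := h0
  set b : Fin k → A ⊗[ℂ] Matrix (Fin r) (Fin r) ℂ := fun j => unit (P j) (i j) 0 with hb
  have hupd : ∀ (j : Fin k) (Q : A) (l : Fin r) (P : Fin k → A) (i : Fin k → Fin r),
      Function.update (fun j => unit (P j) (i j) 0) j (unit Q l 0) =
        fun j' => unit (Function.update P j Q j') (Function.update i j l j') 0 := by
    intro j Q l P i
    ext j' : 1
    by_cases h : j' = j
    · subst h; simp
    · simp [h]
  have hb' : normalProd β y k (Function.update b j₀ (unit 1 i₀ 0)) = 0 := by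
    rw [hb, hupd]
    refine ihm _ _ _ (Nat.le_of_lt_succ ((Finset.card_lt_card ?_).trans_le hm)) le_rfl
    refine Finset.ssubset_iff_subset_ne.2 ⟨fun j hj => ?_, fun h => ?_⟩
    · rw [Finset.mem_filter] at hj ⊢
      by_cases h : j = j₀
      · subst h; simp [hi₀] at hj
      · simpa [h] using hj
    · have : j₀ ∈ Finset.univ.filter fun j => i j = 0 := by simp [hj₀]
      rw [← h] at this
      simp [hi₀] at this
  have happ := apply_normalProd β y (unit (P j₀) 0 i₀) (Function.update b j₀ (unit 1 i₀ 0))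
  rw [hb', map_zero, normalProd_unit_eq_zero hβ hy _ 0 (by simp [unit_mul_unit, hi₀]),
    zero_add] at happ
  -- The raising operator restores the original product at j₀, and also, up to a transposition, at
  -- each entry 1 ⊗ E_{i₀0}. At other entries of row i₀ the result has the same number of entries in
  -- row 0 but one more entry 1 ⊗ E_{i₀0}, so the inner induction kills it.
  have hterm : ∀ j, normalProd β y k (Function.update (Function.update b j₀ (unit 1 i₀ 0)) j
      (unit (P j₀) 0 i₀ * Function.update b j₀ (unit 1 i₀ 0) j)) =
        if j = j₀ ∨ (i j = i₀ ∧ P j = 1) then normalProd β y k b else 0 := by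
    intro j
    by_cases hj : j = j₀
    · subst hj
      have hbj : b j = unit (P j) 0 0 := by simp only [hb, hj₀]
      rw [if_pos (Or.inl rfl), Function.update_self, unit_mul_unit, if_pos rfl,
        Function.update_idem, mul_one, ← hbj, Function.update_eq_self]
    rw [Function.update_of_ne hj, hb, unit_mul_unit]
    by_cases hij : i j = i₀
    swap
    · rw [if_neg (Ne.symm hij), if_neg (by simp [hj, hij]), MultilinearMap.map_update_zero]
    rw [if_pos hij.symm]
    by_cases hP : P j = 1
    · rw [if_pos (Or.inr ⟨hij, hP⟩), ← normalProd_comp_perm y hβ _ (Equiv.swap j₀ j)]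
      congr 1
      ext l : 1
      by_cases hl : l = j₀
      · subst hl; simp [hP, hj₀]
      by_cases hl' : l = j
      · subst hl'; simp [hP, hij, Ne.symm hj]
      · simp [hl, hl', Equiv.swap_apply_of_ne_of_ne]
    · rw [if_neg (by simp [hj, hP]), hupd, hupd]
      refine ihc _ _ ?_ (Nat.le_of_lt_succ ((Finset.card_lt_card ?_).trans_le hc))
      · have hsub : (Finset.univ.filter fun l =>
            Function.update (Function.update i j₀ i₀) j 0 l = 0) ⊆
            insert j ((Finset.univ.filter fun l => i l = 0).erase j₀) := by
          intro l hl
          by_cases h : l = j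
          · simp [h]
          by_cases h' : l = j₀
          · subst h'; simp [hi₀, h] at hl
          · simpa [h, h'] using hl
        refine (Finset.card_le_card hsub).trans ((Finset.card_insert_le _ _).trans ?_)
        rw [Finset.card_erase_add_one (by simp [hj₀])]
        exact hm
      · refine Finset.ssubset_iff_subset_ne.2 ⟨fun l hl => ?_, fun h => ?_⟩
        · by_cases h : l = j
          · subst h; simp [hP]
          by_cases h' : l = j₀
          · subst h'; simp [h] at hl
          · simpa [h, h'] using hl
        · have : j₀ ∈ Finset.univ.filter fun l => ¬ (i l = i₀ ∧ P l = 1) := by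
            simp [hj₀, hi₀.symm]
          rw [← h] at this
          simp [Ne.symm hj] at this
  simp only [hterm] at happ
  -- A multiple of the product is zero, and the multiplicity is positive since j₀ itself is counted.
  rw [← Finset.sum_filter, Finset.sum_const, eq_comm, ← Nat.cast_smul_eq_nsmul ℂ,
    smul_eq_zero] at happ
  refine happ.resolve_left ?_
  rw [Nat.cast_eq_zero, Finset.card_eq_zero]
  exact Finset.Nonempty.ne_empty ⟨j₀, by simp⟩

theorem normalProd_eq_zero_of_column {k : ℕ}
    (h : ∀ (P : Fin k → A) (i : Fin k → Fin r),
      normalProd β y k (fun j => unit (P j) (i j) 0) = 0) : normalProd β y k = 0 := by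
  refine multilinearMap_ext_unit fun P i j => ?_
  rw [zero_apply]
  by_cases hj : ∀ l, j l = 0
  · simp only [hj, h]
  · push Not at hj
    obtain ⟨l, hl⟩ := hj
    exact normalProd_unit_eq_zero hβ hy _ l (by simp [unit_mul_unit, hl])

omit hβ hy in
-- Each further factor contributes n ε(P) from its action and loses ε(P) for each of the k factors
-- already present, whence the falling factorial.
theorem normalProd_unit_zero_zero {n : ℕ} {ε : A →ₐ[ℂ] ℂ}
    (h0 : ∀ P : A, β (unit P 0 0) y = (n * ε P) • y) {k : ℕ} (P : Fin k → A) :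
    normalProd β y k (fun j => unit (P j) 0 0) =
      ((n.descFactorial k : ℂ) * ∏ j, ε (P j)) • y := by
  induction k with
  | zero => simp [normalProd_zero]
  | succ k ih =>
    have hcons : (fun j => unit (P j) (0 : Fin r) 0) =
        (Fin.cons (unit (P 0) 0 0) fun j => unit (P j.succ) 0 0 :
          Fin (k + 1) → A ⊗[ℂ] Matrix (Fin r) (Fin r) ℂ) := by
      ext j : 1
      induction j using Fin.cases <;> simp
    have hupd : ∀ j, normalProd β y k (Function.update (fun j => unit (P j.succ) (0 : Fin r) 0) j
        (unit (P 0) 0 0 * unit (P j.succ) 0 0)) =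
        ((n.descFactorial k : ℂ) * ∏ j, ε (P j)) • y := by
      intro j
      have : Function.update (fun j => unit (P j.succ) (0 : Fin r) 0) j
        (unit (P 0) 0 0 * unit (P j.succ) 0 0) =
          fun l => unit (Function.update (fun j => P j.succ) j (P 0 * P j.succ) l) 0 0 := by
        ext l : 1
        by_cases h : l = j
        · subst h; simp [unit_mul_unit]
        · simp [h]
      rw [this, ih]
      congr 2
      have h2 : ∀ l, ε (Function.update (fun j => P j.succ) j (P 0 * P j.succ) l) =
          (if l = j then ε (P 0) else 1) * ε (P l.succ) := by
        intro l
        by_cases h : l = j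
        · subst h; simp
        · simp [h]
      simp only [h2]
      rw [Finset.prod_mul_distrib, Finset.prod_ite_eq', if_pos (Finset.mem_univ j),
        Fin.prod_univ_succ]
    rw [hcons, normalProd_cons]
    simp only [hupd, ih]
    rw [map_smul, h0, Finset.sum_const, Finset.card_univ, Fintype.card_fin,
      ← Nat.cast_smul_eq_nsmul ℂ, smul_smul, smul_smul, ← sub_smul, Fin.prod_univ_succ,
      Nat.descFactorial_succ]
    congr 1
    by_cases hk : k ≤ n
    · rw [Nat.cast_mul, Nat.cast_sub hk]; ring
    · rw [Nat.descFactorial_eq_zero_iff_lt.2 (not_le.1 hk)]; simp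

/-- Finite dimension gives vanishing at some length K > n, and the scalar action of 1 brings it down
to n + 1, where the factor n - l has not yet met its zero l = n. -/
theorem normalProd_eq_zero [Module.Finite ℂ N] {n : ℕ} {ε : A →ₐ[ℂ] ℂ}
    (h0 : ∀ P : A, β (unit P 0 0) y = (n * ε P) • y) (h1 : ∀ m, β 1 m = (n : ℂ) • m) :
    normalProd β y (n + 1) = 0 := by
  obtain ⟨K, hnK, hK⟩ := exists_normalProd_lower_eq_zero hβ hy n
  refine normalProd_eq_zero_of_le y n h1 (Nat.succ_le_of_lt hnK)
    (fun l hl => Nat.cast_injective.ne (Nat.ne_of_lt hl)) ?_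
  refine normalProd_eq_zero_of_column hβ hy fun P i => ?_
  by_cases hr : ∃ i₀ : Fin r, i₀ ≠ 0
  · obtain ⟨i₀, hi₀⟩ := hr
    exact normalProd_column_eq_zero hβ hy hi₀ hK _ _ P i le_rfl le_rfl
  -- For r = 1 there is no lower row to use, but the falling factorial of n of length K > n is zero.
  · push Not at hr
    have hi : i = fun _ => 0 := funext fun j => hr _
    rw [hi, normalProd_unit_zero_zero h0, Nat.descFactorial_eq_zero_iff_lt.2 hnK]
    simp

end Matrices

/-! ### Modules generated by a highest weight vector of weight `n ω₁` -/

section HighestWeight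

variable {r : ℕ} [NeZero r] {A : Type u} [CommRing A] [Algebra ℂ A]
  {N : Type*} [AddCommGroup N] [Module ℂ N]

/-- For 0 < j < i the vector y has weight 0 for the 𝔰𝔩_2 of the indices j and i, so finite dimension
forces E_{ij} y = 0. Bracketing with P ⊗ E_{jj}, which also kills y, introduces the coefficient P.
-/
theorem apply_unit_eq_zero_of_upper [Module.Finite ℂ N]
    {β : A ⊗[ℂ] Matrix (Fin r) (Fin r) ℂ →ₗ[ℂ] Module.End ℂ N}
    (hβ : ∀ c d, β (c * d - d * c) = β c * β d - β d * β c) {y : N}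
    (hup : ∀ (P : A) (i j : Fin r), i ≤ j → j ≠ 0 → β (unit P i j) y = 0)
    (P : A) (i j : Fin r) (hj : j ≠ 0) : β (unit P i j) y = 0 := by
  by_cases hij : i ≤ j
  · exact hup P i j hij hj
  rw [not_le] at hij
  have hne : i ≠ j := hij.ne'
  have hi : i ≠ 0 := fun h => by rw [h] at hij; exact absurd hij (not_lt.2 (Fin.zero_le j))
  have hlie : ∀ c d, ∀ m, β c (β d m) = β (c * d - d * c) m + β d (β c m) := fun c d m => by
    rw [hβ]; simp
  set h : A ⊗[ℂ] Matrix (Fin r) (Fin r) ℂ := unit 1 j j - unit 1 i i with hh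
  set e : A ⊗[ℂ] Matrix (Fin r) (Fin r) ℂ := unit 1 j i with he
  set f : A ⊗[ℂ] Matrix (Fin r) (Fin r) ℂ := unit 1 i j with hf
  have hef : e * f - f * e = h := by simp [he, hf, hh, unit_mul_unit]
  have hhe : h * e - e * h = (2 : ℂ) • e := by
    simp [he, hh, unit_mul_unit, sub_mul, mul_sub, hne, two_smul]
  have hhf : h * f - f * h = -((2 : ℂ) • f) := by
    simp only [hf, hh, unit_mul_unit, sub_mul, mul_sub, hne.symm, if_true, if_false,
      mul_one, two_smul]
    abel
  have hy : β h y = 0 := by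
    rw [hh, map_sub, LinearMap.sub_apply, hup _ _ _ le_rfl hj, hup _ _ _ le_rfl hi, sub_zero]
  have hey : β e y = 0 := hup _ _ _ hij.le hi
  have hm : β f y = 0 := by
    by_contra hm
    have hhm : β h (β f y) = (-2 : ℂ) • β f y := by
      rw [hlie, hhf, hy]; simp
    have t : IsSl2Triple (β h) (β e) (β f) :=
      { h_ne_zero := fun h0 => by
          rw [h0, LinearMap.zero_apply, eq_comm, smul_eq_zero] at hhm
          exact hm (hhm.resolve_left (by norm_num))
        lie_e_f := by rw [Ring.lie_def, ← hβ, hef]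
        lie_h_e_nsmul := by
          rw [Ring.lie_def, ← hβ, hhe, map_smul, ← Nat.cast_smul_eq_nsmul ℂ, Nat.cast_ofNat]
        lie_h_f_nsmul := by
          rw [Ring.lie_def, ← hβ, hhf, map_neg, map_smul, ← Nat.cast_smul_eq_nsmul ℂ,
            Nat.cast_ofNat] }
    -- A nonzero f y would be primitive of weight -2, while primitive weights in finite dimension
    -- are natural numbers.
    have p : t.HasPrimitiveVectorWith (β f y) (-2 : ℂ) :=
      { ne_zero := hm
        lie_h := hhm
        lie_e := by
          change β e (β f y) = 0
          rw [hlie, hef, hy, hey, map_zero, add_zero] }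
    obtain ⟨k, hk⟩ := p.exists_nat
    have := congrArg Complex.re hk
    simp only [Complex.neg_re, Complex.re_ofNat, Complex.natCast_re] at this
    have := Nat.cast_nonneg (α := ℝ) k
    linarith
  have hc : unit P j j * f - f * unit P j j = - unit P i j := by
    simp [hf, unit_mul_unit, hne.symm]
  have := hlie (unit P j j) f y
  rw [hm, hc, hup P j j le_rfl hj] at this
  simpa using this

theorem weightEval_nsmul_omegaOne (n : ℕ) (x : Matrix (Fin r) (Fin r) ℂ) :
    weightEval (n • omegaOne r) x = n * x 0 0 := by
  simp only [weightEval, omegaOne]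
  rw [Finset.sum_eq_single 0]
  · simp
  · intro i _ hi
    simp [hi]
  · simp

variable {𝔤 : LieSubalgebra ℂ (Matrix (Fin r) (Fin r) ℂ)} (h𝔤 : sl r ≤ 𝔤)

/-- The projection of `𝔤𝔩_r` onto `𝔰𝔩_r ⊆ 𝔤` along the scalar matrices. -/
def tracelessPart : Matrix (Fin r) (Fin r) ℂ →ₗ[ℂ] 𝔤 :=
  LinearMap.codRestrict 𝔤.toSubmodule
    (LinearMap.id - (Matrix.traceLinearMap (Fin r) ℂ ℂ).smulRight ((r : ℂ)⁻¹ • 1))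
    fun x => h𝔤 (by
      have hr : (r : ℂ) ≠ 0 := Nat.cast_ne_zero.2 (NeZero.ne r)
      change Matrix.traceLinearMap (Fin r) ℂ ℂ _ = 0
      simp [hr])

theorem coe_tracelessPart (x : Matrix (Fin r) (Fin r) ℂ) :
    (tracelessPart h𝔤 x : Matrix (Fin r) (Fin r) ℂ) = x - (x.trace * (r : ℂ)⁻¹) • 1 := by
  change x - x.trace • ((r : ℂ)⁻¹ • (1 : Matrix (Fin r) (Fin r) ℂ)) = _
  rw [smul_smul]

theorem tracelessPart_one : tracelessPart h𝔤 1 = 0 := by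
  have hr : (r : ℂ) ≠ 0 := Nat.cast_ne_zero.2 (NeZero.ne r)
  refine Subtype.ext ?_
  rw [coe_tracelessPart]
  simp [hr]

theorem tracelessPart_lie (x z : Matrix (Fin r) (Fin r) ℂ) :
    tracelessPart h𝔤 (x * z - z * x) = ⁅tracelessPart h𝔤 x, tracelessPart h𝔤 z⁆ := by
  refine Subtype.ext ?_
  rw [LieSubalgebra.coe_bracket, coe_tracelessPart, coe_tracelessPart, coe_tracelessPart,
    Ring.lie_def, Matrix.trace_sub, Matrix.trace_mul_comm x z]
  simp only [sub_mul, mul_sub, smul_mul_assoc, mul_smul_comm, one_mul, mul_one, sub_self,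
    zero_mul, zero_smul, sub_zero]
  module

variable [LieRingModule (A ⊗[ℂ] 𝔤) N] [LieModule ℂ (A ⊗[ℂ] 𝔤) N] (ε : A →ₐ[ℂ] ℂ) (n : ℕ)

variable (N) in
/-- The extension to `𝔤𝔩_r ⊗ A` of the action of `𝔰𝔩_r ⊗ A`, for which the scalar matrices act as
on a highest weight vector of weight `n ω₁`. -/
def extendedAct : A ⊗[ℂ] Matrix (Fin r) (Fin r) ℂ →ₗ[ℂ] Module.End ℂ N :=
  (LieModule.toEnd ℂ (A ⊗[ℂ] 𝔤) N : A ⊗[ℂ] 𝔤 →ₗ[ℂ] Module.End ℂ N) ∘ₗ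
      (tracelessPart h𝔤).lTensor A +
    (LinearMap.mul' ℂ ℂ ∘ₗ TensorProduct.map ε.toLinearMap
      (((n : ℂ) * (r : ℂ)⁻¹) • Matrix.traceLinearMap (Fin r) ℂ ℂ)).smulRight 1

theorem extendedAct_tmul (P : A) (x : Matrix (Fin r) (Fin r) ℂ) (m : N) :
    extendedAct N h𝔤 ε n (P ⊗ₜ x) m = ⁅P ⊗ₜ[ℂ] tracelessPart h𝔤 x, m⁆ +
      (n * (x.trace * (r : ℂ)⁻¹) * ε P) • m := by
  simp only [extendedAct, LinearMap.add_apply, LinearMap.comp_apply, LinearMap.lTensor_tmul,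
    LinearMap.smulRight_apply, TensorProduct.map_tmul, LinearMap.mul'_apply,
    LinearMap.smul_apply, Module.End.one_apply]
  congr 2
  simp
  ring

theorem extendedAct_tmul_one (P : A) (m : N) :
    extendedAct N h𝔤 ε n (P ⊗ₜ 1) m = (n * ε P) • m := by
  have hr : (r : ℂ) ≠ 0 := Nat.cast_ne_zero.2 (NeZero.ne r)
  rw [extendedAct_tmul, tracelessPart_one, TensorProduct.tmul_zero, zero_lie, zero_add]
  simp [hr]

/-- The scalar part depends on the trace only, which vanishes on commutators of matrices, and taking
traceless parts respects brackets. -/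
theorem extendedAct_lie (c d : A ⊗[ℂ] Matrix (Fin r) (Fin r) ℂ) :
    extendedAct N h𝔤 ε n (c * d - d * c) =
      extendedAct N h𝔤 ε n c * extendedAct N h𝔤 ε n d -
        extendedAct N h𝔤 ε n d * extendedAct N h𝔤 ε n c := by
  induction c using TensorProduct.induction_on with
  | zero => simp
  | add c₁ c₂ h₁ h₂ =>
    rw [add_mul, mul_add, add_sub_add_comm, map_add, h₁, h₂, map_add, add_mul, mul_add]
    abel
  | tmul P x =>
    induction d using TensorProduct.induction_on with
    | zero => simp
    | add c₁ c₂ h₁ h₂ =>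
      rw [add_mul, mul_add, add_sub_add_comm, map_add, h₁, h₂, map_add, add_mul, mul_add]
      abel
    | tmul Q z =>
      refine LinearMap.ext fun m => ?_
      rw [Algebra.TensorProduct.tmul_mul_tmul, Algebra.TensorProduct.tmul_mul_tmul, mul_comm Q P,
        ← TensorProduct.tmul_sub, LinearMap.sub_apply, Module.End.mul_apply,
        Module.End.mul_apply]
      simp only [extendedAct_tmul, tracelessPart_lie, Matrix.trace_sub,
        Matrix.trace_mul_comm x z, sub_self, zero_mul, mul_zero, zero_smul, add_zero,
        lie_add, lie_smul, smul_add, smul_smul]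
      rw [← LieAlgebra.ExtendScalars.bracket_tmul, lie_lie,
        mul_comm (n * (x.trace * (r : ℂ)⁻¹) * ε P)]
      abel

variable {ε n} {y : N} (hy : IsHighestWeightVector 𝔤 ε (n • omegaOne r) y)
include hy

theorem extendedAct_tmul_of_mem_borel (P : A) (x : Matrix (Fin r) (Fin r) ℂ)
    (hx : x ∈ borel r) : extendedAct N h𝔤 ε n (P ⊗ₜ x) y = (n * x 0 0 * ε P) • y := by
  rw [extendedAct_tmul, hy, ← add_smul, weightEval_nsmul_omegaOne, coe_tracelessPart]
  · congr 1
    simp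
    ring
  · rw [coe_tracelessPart]
    exact sub_mem hx ((borel r).smul_mem _ Matrix.blockTriangular_one)

theorem extendedAct_unit_eq_zero [Module.Finite ℂ N] (P : A) (i j : Fin r) (hj : j ≠ 0) :
    extendedAct N h𝔤 ε n (unit P i j) y = 0 := by
  refine apply_unit_eq_zero_of_upper (extendedAct_lie h𝔤 ε n) (fun P i j hij hj => ?_) P i j hj
  rw [unit, extendedAct_tmul_of_mem_borel h𝔤 hy]
  · simp [hj]
  · intro a b hab
    refine Matrix.single_apply_of_ne _ _ _ _ _ fun h => ?_
    rw [← h.1, ← h.2] at hab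
    exact absurd hij (not_le.2 hab)

theorem extendedAct_unit_zero_zero (P : A) :
    extendedAct N h𝔤 ε n (unit P 0 0) y = (n * ε P) • y := by
  rw [unit, extendedAct_tmul_of_mem_borel h𝔤 hy]
  · simp
  · intro a b hab
    refine Matrix.single_apply_of_ne _ _ _ _ _ fun h => ?_
    rw [← h.1, ← h.2] at hab
    exact absurd hab (lt_irrefl _)

theorem normalProd_extendedAct_eq_zero [Module.Finite ℂ N] :
    normalProd (extendedAct N h𝔤 ε n) y (n + 1) = 0 :=
  normalProd_eq_zero (extendedAct_lie h𝔤 ε n) (extendedAct_unit_eq_zero h𝔤 hy)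
    (extendedAct_unit_zero_zero h𝔤 hy) fun m => by
      rw [Algebra.TensorProduct.one_def, extendedAct_tmul_one, map_one, mul_one]

/-- The two actions can differ only on scalar matrices lying in 𝔤. These are central, so the vectors
on which P ⊗ w acts by its eigenvalue on y form a submodule containing the generator. -/
theorem extendedAct_tmul_coe (hgen : LieSubmodule.lieSpan ℂ (A ⊗[ℂ] 𝔤) {y} = ⊤) (P : A) (x : 𝔤)
    (m : N) : extendedAct N h𝔤 ε n (P ⊗ₜ (x : Matrix (Fin r) (Fin r) ℂ)) m =
      ⁅P ⊗ₜ[ℂ] x, m⁆ := by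
  set w : 𝔤 := x - tracelessPart h𝔤 x
  set a : ℂ := (x : Matrix (Fin r) (Fin r) ℂ).trace * (r : ℂ)⁻¹ with ha
  have hw : (w : Matrix (Fin r) (Fin r) ℂ) = a • 1 := by
    simp [w, coe_tracelessPart, ha]
  have hcentral : ∀ u : A ⊗[ℂ] 𝔤, ⁅P ⊗ₜ[ℂ] w, u⁆ = 0 := by
    intro u
    induction u using TensorProduct.induction_on with
    | zero => exact (LieAlgebra.ad ℂ (A ⊗[ℂ] 𝔤) (P ⊗ₜ[ℂ] w)).map_zero
    | add u₁ u₂ h₁ h₂ =>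
      refine ((LieAlgebra.ad ℂ (A ⊗[ℂ] 𝔤) (P ⊗ₜ[ℂ] w)).map_add u₁ u₂).trans ?_
      rw [LieAlgebra.ad_apply, LieAlgebra.ad_apply, h₁, h₂, add_zero]
    | tmul Q z =>
      rw [LieAlgebra.ExtendScalars.bracket_tmul]
      have : ⁅w, z⁆ = 0 := by
        refine Subtype.ext ?_
        rw [LieSubalgebra.coe_bracket, hw, Ring.lie_def]
        simp
      rw [this, TensorProduct.tmul_zero]
  have hscalar : ∀ m : N, ⁅P ⊗ₜ[ℂ] w, m⁆ = (n * a * ε P) • m := by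
    let S : LieSubmodule ℂ (A ⊗[ℂ] 𝔤) N :=
      { carrier := {m | ⁅P ⊗ₜ[ℂ] w, m⁆ = (n * a * ε P) • m}
        add_mem' := fun {m m'} (h : _ = _) (h' : _ = _) => by
          change _ = _
          rw [lie_add, h, h', smul_add]
        zero_mem' := by change _ = _; rw [lie_zero, smul_zero]
        smul_mem' := fun c m (h : _ = _) => by
          change _ = _
          rw [lie_smul, h, smul_comm]
        lie_mem := fun {u m} (h : _ = _) => by
          change _ = _
          rw [leibniz_lie, hcentral, zero_lie, zero_add, h, lie_smul] }
    have hS : LieSubmodule.lieSpan ℂ (A ⊗[ℂ] 𝔤) {y} ≤ S := by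
      rw [LieSubmodule.lieSpan_le, Set.singleton_subset_iff]
      change _ = _
      rw [hy w _ P, weightEval_nsmul_omegaOne, hw]
      · simp
      · rw [hw]
        exact (borel r).smul_mem _ Matrix.blockTriangular_one
    exact fun m => hS (hgen ▸ LieSubmodule.mem_top m)
  rw [extendedAct_tmul, ← ha, ← hscalar, ← add_lie, ← TensorProduct.tmul_add]
  simp [w]

end HighestWeight

/-! ### Sums over permutations as normally ordered products -/

section Permutations

variable {B : Type*} [Ring B] [Algebra ℂ B] {N : Type*} [AddCommGroup N] [Module ℂ N]
  {β : B →ₗ[ℂ] Module.End ℂ N}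

theorem normalProd_mem {y : N} (S : Submodule ℂ N) (hS : ∀ c, ∀ m ∈ S, β c m ∈ S) (hy : y ∈ S)
    {k : ℕ} (b : Fin k → B) : normalProd β y k b ∈ S := by
  induction k with
  | zero => exact hy
  | succ k ih =>
    rw [← Fin.cons_self_tail b, normalProd_cons]
    exact sub_mem (hS _ _ (ih _)) (sum_mem fun j _ => ih _)

variable {n : ℕ} {ι : Fin n → B →ₐ[ℂ] Module.End ℂ N} {X D : Type*} {G : (Fin n → X) → N}
  {φ : D → B} {a : D → X → X}
  (hG : ∀ i d g, ι i (φ d) (G g) = G (Function.update g i (a d (g i))))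
include hG

theorem places_prod_apply {k : ℕ} (τ : Fin k → Fin n) (hτ : Function.Injective τ) (b : Fin k → D)
    (g g' : Fin n → X) (h : ∀ l, g' (τ l) = a (b l) (g (τ l)))
    (h' : ∀ i, i ∉ Set.range τ → g' i = g i) :
    (List.ofFn fun l => ι (τ l) (φ (b l))).prod (G g) = G g' := by
  induction k generalizing g' with
  | zero =>
    have : g' = g := funext fun i => h' i fun ⟨l, _⟩ => l.elim0
    simp [this]
  | succ k ih =>
    rw [List.ofFn_succ, List.prod_cons, Module.End.mul_apply,
      ih (fun l => τ l.succ) (hτ.comp (Fin.succ_injective k)) (fun l => b l.succ)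
        -- The head of the product acts last, so before it acts the place τ 0 still carries its
        -- value in g.
        (Function.update g' (τ 0) (g (τ 0))), hG]
    · rw [Function.update_self, ← h 0, Function.update_idem, Function.update_eq_self]
    · intro l
      rw [Function.update_of_ne (fun e => Fin.succ_ne_zero l (hτ e)), h]
    · intro i hi
      by_cases hi0 : i = τ 0
      · subst hi0; simp
      · rw [Function.update_of_ne hi0, h']
        rintro ⟨l, rfl⟩
        induction l using Fin.cases with
        | zero => exact hi0 rfl
        | succ l => exact hi ⟨l, rfl⟩

/-- With as many factors as places, the injective placements are the permutations. -/
theorem normalProd_eq_sum_perm (hι : ∀ i j, i ≠ j → ∀ c d, Commute (ι i c) (ι j d))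
    (hβ : ∀ c, β c = ∑ i, ι i c) (g : Fin n → X) (b : Fin n → D) :
    normalProd β (G g) n (fun j => φ (b j)) =
      ∑ σ : Equiv.Perm (Fin n), G fun i => a (b (σ.symm i)) (g i) := by
  rw [normalProd_eq_sum_places _ ι hι hβ]
  symm
  refine Finset.sum_bij (fun σ _ => ⇑σ) (fun σ _ => by simp [σ.injective])
    (fun σ _ τ _ h => Equiv.coe_fn_injective h) (fun τ hτ => ?_) fun σ _ => ?_
  · rw [Finset.mem_filter] at hτ
    exact ⟨Equiv.ofBijective τ (Finite.injective_iff_bijective.1 hτ.2), Finset.mem_univ _, rfl⟩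
  · symm
    refine places_prod_apply hG _ σ.injective b g _ (fun l => by simp) fun i hi => ?_
    exact absurd ⟨σ.symm i, by simp⟩ hi

end Permutations

/-! ### Power sums generate the symmetric tensors. -/

section SymmetricTensors

variable {n : ℕ} {A : Type u} [CommRing A] [Algebra ℂ A]

theorem singleAlgHom_mul_tprod (k : Fin n) (P : A) (p : Fin n → A) :
    PiTensorProduct.singleAlgHom (R := ℂ) (A := fun _ => A) k P * PiTensorProduct.tprod ℂ p =
      PiTensorProduct.tprod ℂ (Function.update p k (P * p k)) := by
  rw [PiTensorProduct.singleAlgHom_apply, PiTensorProduct.tprod_mul_tprod]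
  congr 1
  ext i
  by_cases h : i = k
  · subst h; simp
  · simp [h]

/-- The power sum `∑_k ι_k(Q)` in `S^n(A)`. -/
def powerSum (n : ℕ) {A : Type u} [CommRing A] [Algebra ℂ A] (Q : A) : ⨂[ℂ] _ : Fin n, A :=
  ∑ k, PiTensorProduct.singleAlgHom (R := ℂ) (A := fun _ => A) k Q

/-- A polarised form of Newton's identities: let c in A act on A^{⊗n} by its power sum. The normally
ordered product on 1 is then the symmetrisation of a pure tensor, and its recursion never leaves S.
-/
theorem sum_tensorPerm_mem (S : Subalgebra ℂ (⨂[ℂ] _ : Fin n, A))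
    (hS : ∀ Q, powerSum n Q ∈ S) (s : ⨂[ℂ] _ : Fin n, A) :
    ∑ σ, tensorPerm n A σ s ∈ S := by
  induction s using PiTensorProduct.induction_on with
  | add s t hs ht =>
    simp only [map_add, Finset.sum_add_distrib]
    exact add_mem hs ht
  | smul_tprod c p =>
    simp only [map_smul, ← Finset.smul_sum]
    refine S.smul_mem ?_ c
    let ι : Fin n → A →ₐ[ℂ] Module.End ℂ (⨂[ℂ] _ : Fin n, A) := fun i =>
      (Algebra.lmul ℂ (⨂[ℂ] _ : Fin n, A)).comp (PiTensorProduct.singleAlgHom (R := ℂ) (A := fun _ => A) i)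
    let β : A →ₗ[ℂ] Module.End ℂ (⨂[ℂ] _ : Fin n, A) := ∑ i, (ι i).toLinearMap
    have hβ : ∀ c, β c = ∑ i, ι i c := fun c => by simp [β]
    have h := normalProd_eq_sum_perm (β := β) (ι := ι) (G := fun p => PiTensorProduct.tprod ℂ p)
      (φ := id) (a := fun c x => c * x) (fun i c g => singleAlgHom_mul_tprod i c g)
      (fun i j _ c d => (Commute.all _ _).map (Algebra.lmul ℂ (⨂[ℂ] _ : Fin n, A)))
      hβ (fun _ => 1) p
    have hmem := normalProd_mem (β := β) (y := (1 : ⨂[ℂ] _ : Fin n, A)) S.toSubmodule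
      (fun c m hm => by
        have : β c m = powerSum n c * m := by
          simp [hβ, ι, powerSum, Finset.sum_mul, LinearMap.sum_apply]
        rw [this]
        exact S.mul_mem (hS c) hm) S.one_mem p
    rw [PiTensorProduct.one_def] at hmem
    rw [Pi.one_def] at hmem
    replace hmem := h ▸ hmem
    convert hmem using 2 with σ
    simp [tensorPerm]

theorem mem_of_mem_invariants (S : Subalgebra ℂ (⨂[ℂ] _ : Fin n, A))
    (hS : ∀ Q, powerSum n Q ∈ S) {s : ⨂[ℂ] _ : Fin n, A} (hs : s ∈ (tensorPerm n A).invariants) :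
    s ∈ S := by
  have h := sum_tensorPerm_mem S hS s
  rw [Finset.sum_congr rfl fun σ _ => hs σ, Finset.sum_const, Finset.card_univ,
    ← Nat.cast_smul_eq_nsmul ℂ] at h
  have hc : (Fintype.card (Equiv.Perm (Fin n)) : ℂ) ≠ 0 := Nat.cast_ne_zero.2 Fintype.card_ne_zero
  simpa [smul_smul, hc] using S.smul_mem h (Fintype.card (Equiv.Perm (Fin n)) : ℂ)⁻¹

theorem tensorPerm_singleAlgHom (σ : Equiv.Perm (Fin n)) (k : Fin n) (Q : A) :
    tensorPerm n A σ (PiTensorProduct.singleAlgHom (R := ℂ) (A := fun _ => A) k Q) =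
      PiTensorProduct.singleAlgHom (R := ℂ) (A := fun _ => A) (σ k) Q := by
  simp only [tensorPerm, MonoidHom.coe_mk, OneHom.coe_mk, LinearEquiv.coe_coe,
    PiTensorProduct.singleAlgHom_apply, PiTensorProduct.reindex_tprod]
  congr 1
  ext i
  by_cases h : i = σ k
  · subst h; simp
  · have h' : σ.symm i ≠ k := fun e => h (by rw [← e]; simp)
    simp [h, h']

theorem powerSum_mem_invariants (Q : A) : powerSum n Q ∈ (tensorPerm n A).invariants := by
  intro σ
  rw [powerSum, map_sum, ← Equiv.sum_comp σ fun k =>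
    PiTensorProduct.singleAlgHom (R := ℂ) (A := fun _ => A) k Q]
  exact Finset.sum_congr rfl fun k _ => tensorPerm_singleAlgHom σ k Q

theorem tensorAug_tprod (ε : A →ₐ[ℂ] ℂ) (p : Fin n → A) :
    tensorAug n ε (PiTensorProduct.tprod ℂ p) = ∏ i, ε (p i) := by
  rw [tensorAug]
  erw [PiTensorProduct.liftAlgHom_apply]
  rw [PiTensorProduct.lift.tprod]
  rfl

theorem tensorAug_powerSum (ε : A →ₐ[ℂ] ℂ) (Q : A) : tensorAug n ε (powerSum n Q) = n * ε Q := by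
  have h : ∀ k : Fin n, tensorAug n ε
      (PiTensorProduct.singleAlgHom (R := ℂ) (A := fun _ => A) k Q) = ε Q := by
    intro k
    rw [PiTensorProduct.singleAlgHom_apply, tensorAug_tprod, Finset.prod_eq_single k]
    · simp
    · intro i _ hi
      simp [hi]
    · simp
  rw [powerSum, map_sum, Finset.sum_congr rfl fun k _ => h k]
  simp

end SymmetricTensors

/-! ### The symbol map from `V^{⊗n} ⊗ A^{⊗n}` -/

section Symbol

variable {r : ℕ} [NeZero r] {A : Type u} [CommRing A] [Algebra ℂ A]

variable (r A) in
/-- `u ⊗ P ↦ P ⊗ x`, where the matrix `x` has first column `u` and other columns zero. -/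
def columnMap : (Fin r → ℂ) →ₗ[ℂ] A →ₗ[ℂ] A ⊗[ℂ] Matrix (Fin r) (Fin r) ℂ :=
  LinearMap.mk₂ ℂ (fun u P => P ⊗ₜ[ℂ] Matrix.vecMulVec u (Pi.single 0 1))
    (fun u v P => by rw [Matrix.add_vecMulVec, TensorProduct.tmul_add])
    (fun c u P => by rw [Matrix.smul_vecMulVec, TensorProduct.tmul_smul])
    (fun u P Q => TensorProduct.add_tmul _ _ _)
    (fun c u P => TensorProduct.smul_tmul' _ _ _ |>.symm)

theorem columnMap_apply (u : Fin r → ℂ) (P : A) :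
    columnMap r A u P = P ⊗ₜ[ℂ] Matrix.vecMulVec u (Pi.single 0 1) := rfl

theorem tmul_mul_columnMap (P Q : A) (x : Matrix (Fin r) (Fin r) ℂ) (u : Fin r → ℂ) :
    (P ⊗ₜ[ℂ] x) * columnMap r A u Q = columnMap r A (x.mulVec u) (P * Q) := by
  rw [columnMap_apply, columnMap_apply, Algebra.TensorProduct.tmul_mul_tmul,
    Matrix.mul_vecMulVec]

theorem columnMap_mul_unit (P Q : A) (u : Fin r → ℂ) :
    columnMap r A u P * unit Q 0 0 = columnMap r A u (Q * P) := by
  rw [columnMap_apply, columnMap_apply, unit, Algebra.TensorProduct.tmul_mul_tmul,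
    Matrix.vecMulVec_mul, mul_comm P Q]
  congr 2
  ext j
  by_cases hj : j = 0
  · subst hj; simp
  · simp [hj, Ne.symm hj]

variable {N : Type*} [AddCommGroup N] [Module ℂ N]
  (β : A ⊗[ℂ] Matrix (Fin r) (Fin r) ℂ →ₗ[ℂ] Module.End ℂ N) (y : N) (n : ℕ)

/-- The linear map `V^{⊗n} ⊗ A^{⊗n} → N` given by the normally ordered products of the columns
`u_j ⊗ P_j` acting on `y`. -/
def symbolMap : VTensor r n →ₗ[ℂ] (⨂[ℂ] _ : Fin n, A) →ₗ[ℂ] N :=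
  (PiTensorProduct.map₂ fun _ : Fin n => columnMap r A).compr₂
    (PiTensorProduct.lift (normalProd β y n))

theorem symbolMap_tprod (u : Fin n → Fin r → ℂ) (p : Fin n → A) :
    symbolMap β y n (PiTensorProduct.tprod ℂ u) (PiTensorProduct.tprod ℂ p) =
      normalProd β y n fun j => columnMap r A (u j) (p j) := by
  rw [symbolMap, LinearMap.compr₂_apply, PiTensorProduct.map₂_tprod_tprod,
    PiTensorProduct.lift.tprod]

omit [NeZero r] in
variable {N' : Type*} [AddCommGroup N'] [Module ℂ N'] in
theorem tensor_hom_ext {f g : VTensor r n →ₗ[ℂ] (⨂[ℂ] _ : Fin n, A) →ₗ[ℂ] N'}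
    (h : ∀ u p, f (PiTensorProduct.tprod ℂ u) (PiTensorProduct.tprod ℂ p) =
      g (PiTensorProduct.tprod ℂ u) (PiTensorProduct.tprod ℂ p)) : f = g :=
  PiTensorProduct.ext (MultilinearMap.ext fun u =>
    PiTensorProduct.ext (MultilinearMap.ext fun p => h u p))

variable {β y n}

/-- Once the product of length n + 1 is gone, `apply_normalProd` is exactly the formula for the
current action on V^{⊗n} ⊗ A^{⊗n}. -/
theorem apply_symbolMap (hvan : normalProd β y (n + 1) = 0) (P : A)
    (x : Matrix (Fin r) (Fin r) ℂ) (w : VTensor r n) (h : ⨂[ℂ] _ : Fin n, A) :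
    β (P ⊗ₜ x) (symbolMap β y n w h) = ∑ k, symbolMap β y n (factorAct r n k x w)
      (PiTensorProduct.singleAlgHom (R := ℂ) (A := fun _ => A) k P * h) := by
  have key : (symbolMap β y n).compr₂ (β (P ⊗ₜ x)) = ∑ k,
      (symbolMap β y n).compl₁₂ (factorAct r n k x)
        (LinearMap.mulLeft ℂ (PiTensorProduct.singleAlgHom (R := ℂ) (A := fun _ => A) k P)) := by
    refine tensor_hom_ext n fun u p => ?_
    simp only [LinearMap.compr₂_apply, LinearMap.sum_apply, LinearMap.compl₁₂_apply,
      LinearMap.mulLeft_apply, factorAct_tprod, singleAlgHom_mul_tprod, symbolMap_tprod]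
    rw [apply_normalProd, hvan, zero_apply, zero_add]
    refine Finset.sum_congr rfl fun k _ => congrArg _ (funext fun i => ?_)
    by_cases hi : i = k
    · subst hi; simp [tmul_mul_columnMap]
    · simp [hi]
  simpa using LinearMap.congr_fun (LinearMap.congr_fun key w) h

/-! ### Factorisation of the symbol map through the diagonal harmonics. -/

section Augmentation

variable (hβ : ∀ c d, β (c * d - d * c) = β c * β d - β d * β c)
  (hvan : normalProd β y (n + 1) = 0) {ε : A →ₐ[ℂ] ℂ}
  (h0 : ∀ P : A, β (unit P 0 0) y = (n * ε P) • y)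
include hβ hvan h0

/-- The product on (Q ⊗ E_{00}) y is computed in two ways: as a scalar multiple, and by
`normalProd_apply`, where right multiplication by Q ⊗ E_{00} multiplies the coefficient of a first
column by Q. -/
theorem symbolMap_powerSum_mul (Q : A) (w : VTensor r n) (h : ⨂[ℂ] _ : Fin n, A) :
    symbolMap β y n w (powerSum n Q * h) = (n * ε Q) • symbolMap β y n w h := by
  have key : (symbolMap β y n).compl₂ (LinearMap.mulLeft ℂ (powerSum n Q)) =
      ((n : ℂ) * ε Q) • symbolMap β y n := by
    refine tensor_hom_ext n fun u p => ?_
    have hsmul : normalProd β ((n * ε Q) • y) n (fun j => columnMap r A (u j) (p j)) =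
        (n * ε Q) • normalProd β y n (fun j => columnMap r A (u j) (p j)) := by
      have : ∀ (a : ℂ) (k : ℕ) (b : Fin k → A ⊗[ℂ] Matrix (Fin r) (Fin r) ℂ),
          normalProd β (a • y) k b = a • normalProd β y k b := by
        intro a k
        induction k with
        | zero => intro b; rfl
        | succ k ih =>
          intro b
          rw [← Fin.cons_self_tail b, normalProd_cons, normalProd_cons, smul_sub,
            Finset.smul_sum, ih, map_smul]
          simp only [ih]
      exact this _ _ _
    simp only [LinearMap.compl₂_apply, LinearMap.mulLeft_apply, LinearMap.smul_apply]
    rw [symbolMap_tprod, ← hsmul, ← h0, normalProd_apply y hβ, hvan, zero_apply, zero_add,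
      powerSum, Finset.sum_mul, map_sum]
    refine Finset.sum_congr rfl fun k _ => ?_
    rw [singleAlgHom_mul_tprod, symbolMap_tprod, columnMap_mul_unit]
    refine congrArg _ (funext fun i => ?_)
    by_cases hi : i = k
    · subst hi; simp
    · simp [hi]
  exact LinearMap.congr_fun (LinearMap.congr_fun key w) h

theorem symbolMap_mul_of_mem_invariants {s : ⨂[ℂ] _ : Fin n, A}
    (hs : s ∈ (tensorPerm n A).invariants) (w : VTensor r n) (h : ⨂[ℂ] _ : Fin n, A) :
    symbolMap β y n w (s * h) = tensorAug n ε s • symbolMap β y n w h := by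
  let S : Subalgebra ℂ (⨂[ℂ] _ : Fin n, A) :=
    { carrier := {s | ∀ h, symbolMap β y n w (s * h) = tensorAug n ε s • symbolMap β y n w h}
      mul_mem' := fun {s t} (hs : ∀ h, _) (ht : ∀ h, _) h => by
        rw [mul_assoc, hs, ht, smul_smul, map_mul]
      add_mem' := fun {s t} (hs : ∀ h, _) (ht : ∀ h, _) h => by
        rw [add_mul, map_add, hs, ht, map_add, add_smul]
      algebraMap_mem' := fun c _ => by
        rw [← Algebra.smul_def, map_smul, AlgHom.commutes]
        rfl }
  exact mem_of_mem_invariants S (fun Q h => by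
    rw [symbolMap_powerSum_mul hβ hvan h0, tensorAug_powerSum]) hs h

theorem symbolMap_harmonicIdeal (w : VTensor r n) {h : ⨂[ℂ] _ : Fin n, A}
    (hh : h ∈ harmonicIdeal n ε) : symbolMap β y n w h = 0 := by
  -- The extra factor a absorbs the coefficients b of an ideal element in the span induction.
  suffices ∀ a, symbolMap β y n w (h * a) = 0 by simpa using this 1
  induction hh using Submodule.span_induction with
  | mem s hs =>
    intro a
    rw [symbolMap_mul_of_mem_invariants hβ hvan h0 hs.1, hs.2, zero_smul]
  | zero => intro a; rw [zero_mul, map_zero]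
  | add s t _ _ hs ht => intro a; rw [add_mul, map_add, hs, ht, add_zero]
  | smul b s _ hs =>
    intro a
    rw [smul_eq_mul, mul_comm b, mul_assoc]
    exact hs _

/-- The map induced by the symbol map on `V^{⊗n} ⊗ DH_n(A)`. -/
def harmonicSymbolMap : VTensor r n ⊗[ℂ] DH n ε →ₗ[ℂ] N :=
  TensorProduct.lift (((((harmonicIdeal n ε).restrictScalars ℂ).liftQ (symbolMap β y n).flip
    fun _ hh => LinearMap.ext fun w => symbolMap_harmonicIdeal hβ hvan h0 w hh) ∘ₗ
      (Submodule.Quotient.restrictScalarsEquiv ℂ (harmonicIdeal n ε)).symm.toLinearMap).flip)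

theorem harmonicSymbolMap_tmul (w : VTensor r n) (h : ⨂[ℂ] _ : Fin n, A) :
    harmonicSymbolMap hβ hvan h0 (w ⊗ₜ[ℂ] Ideal.Quotient.mk (harmonicIdeal n ε) h) =
      symbolMap β y n w h := rfl

end Augmentation

end Symbol

/-! ### The diagonal harmonics are finite-dimensional -/

section Harmonics

variable {A : Type u} [CommRing A] [Algebra ℂ A] {n : ℕ} {ε : A →ₐ[ℂ] ℂ}

/-- Subtracting its augmentation from s leaves a generator of the harmonic ideal. -/
theorem mk_eq_tensorAug {s : ⨂[ℂ] _ : Fin n, A} (hs : s ∈ (tensorPerm n A).invariants) :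
    Ideal.Quotient.mk (harmonicIdeal n ε) s = algebraMap ℂ (DH n ε) (tensorAug n ε s) := by
  change _ = Ideal.Quotient.mk (harmonicIdeal n ε) (algebraMap ℂ _ (tensorAug n ε s))
  rw [Ideal.Quotient.eq]
  refine Ideal.subset_span ⟨Submodule.sub_mem _ hs fun σ => ?_, by simp⟩
  exact (tensorPermAlgHom n A σ).commutes _

/-- ι_k(Q) is a root of the monic polynomial ∏_l (X - ι_l(Q)), whose coefficients are symmetric and
so become scalars in DH_n(A). -/
theorem isIntegral_mk_singleAlgHom (k : Fin n) (Q : A) :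
    IsIntegral ℂ (Ideal.Quotient.mk (harmonicIdeal n ε)
      (PiTensorProduct.singleAlgHom (R := ℂ) (A := fun _ => A) k Q)) := by
  set q : Polynomial (⨂[ℂ] _ : Fin n, A) := ∏ l, (Polynomial.X -
    Polynomial.C (PiTensorProduct.singleAlgHom (R := ℂ) (A := fun _ => A) l Q)) with hq
  have hmonic : q.Monic := Polynomial.monic_prod_of_monic _ _ fun l _ => Polynomial.monic_X_sub_C _
  have hinv : ∀ i, q.coeff i ∈ (tensorPerm n A).invariants := by
    intro i σ
    have h : q.map (tensorPermAlgHom n A σ : _ →+* _) = q := by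
      rw [hq, Polynomial.map_prod, ← Equiv.prod_comp σ (fun l => Polynomial.X -
        Polynomial.C (PiTensorProduct.singleAlgHom (R := ℂ) (A := fun _ => A) l Q))]
      refine Finset.prod_congr rfl fun l _ => ?_
      rw [Polynomial.map_sub, Polynomial.map_X, Polynomial.map_C, ← tensorPerm_singleAlgHom]
      rfl
    conv_rhs => rw [← h, Polynomial.coeff_map]
    rfl
  refine ⟨q.map (tensorAug n ε : _ →+* ℂ), hmonic.map _, ?_⟩
  rw [← Polynomial.eval_map]
  have h : (q.map (tensorAug n ε : _ →+* ℂ)).map (algebraMap ℂ (DH n ε)) =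
      q.map (Ideal.Quotient.mk (harmonicIdeal n ε)) := by
    ext i
    rw [Polynomial.coeff_map, Polynomial.coeff_map, Polynomial.coeff_map, mk_eq_tensorAug (hinv i)]
    rfl
  rw [h, Polynomial.eval_map, Polynomial.eval₂_hom, hq, Polynomial.eval_prod,
    Finset.prod_eq_zero (Finset.mem_univ k) (by simp), map_zero]

theorem finite_DH [Algebra.FiniteType ℂ A] : Module.Finite ℂ (DH n ε) := by
  obtain ⟨s, hs⟩ := Algebra.FiniteType.out (R := ℂ) (A := A)
  let mkₐ : Fin n → A →ₐ[ℂ] DH n ε := fun k => (Ideal.Quotient.mkₐ ℂ (harmonicIdeal n ε)).comp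
    (PiTensorProduct.singleAlgHom (R := ℂ) (A := fun _ => A) k)
  set S : Set (DH n ε) := ⋃ k, mkₐ k '' s
  have hfin : S.Finite := Set.finite_iUnion fun k => s.finite_toSet.image _
  have hint : ∀ x ∈ S, IsIntegral ℂ x := by
    intro x hx
    obtain ⟨k, a, _, rfl⟩ := Set.mem_iUnion.1 hx
    exact isIntegral_mk_singleAlgHom k a
  have hsingle : ∀ k a, mkₐ k a ∈ Algebra.adjoin ℂ S := by
    intro k a
    have h : (Algebra.adjoin ℂ (s : Set A)).map (mkₐ k) ≤ Algebra.adjoin ℂ S := by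
      rw [AlgHom.map_adjoin]
      exact Algebra.adjoin_mono (Set.subset_iUnion (fun k => mkₐ k '' s) k)
    exact h ⟨a, by rw [hs]; trivial, rfl⟩
  have htop : Algebra.adjoin ℂ S = ⊤ := by
    rw [eq_top_iff]
    rintro q -
    obtain ⟨t, rfl⟩ := Ideal.Quotient.mk_surjective q
    induction t using PiTensorProduct.induction_on with
    | add t₁ t₂ h₁ h₂ => rw [map_add]; exact add_mem h₁ h₂
    | smul_tprod c p =>
      have hp : PiTensorProduct.tprod ℂ p =
          ∏ k, PiTensorProduct.singleAlgHom (R := ℂ) (A := fun _ => A) k (p k) := by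
        simp only [PiTensorProduct.singleAlgHom_apply]
        rw [← PiTensorProduct.tprod_prod]
        congr 1
        exact (Finset.univ_prod_mulSingle p).symm
      change c • Ideal.Quotient.mkₐ ℂ (harmonicIdeal n ε) (PiTensorProduct.tprod ℂ p) ∈ _
      rw [hp, map_prod]
      exact Subalgebra.smul_mem _ (Subalgebra.prod_mem _ fun k _ => hsingle k (p k)) c
  have := fg_adjoin_of_finite hfin hint
  rw [htop, Algebra.top_toSubmodule] at this
  exact ⟨this⟩

end Harmonics

/-! ### The highest weight vector of `∇(DH_n(A))` -/

section NablaHarmonics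

variable {r : ℕ} {A : Type u} [CommRing A] [Algebra ℂ A] {n : ℕ} {ε : A →ₐ[ℂ] ℂ}

variable (r n ε) in
/-- The inclusion of `∇(DH_n(A))` into `V^{⊗n} ⊗ DH_n(A)`. -/
def nablaIncl : Nabla r (dhRep n ε) →ₗ[ℂ] VTensor r n ⊗[ℂ] DH n ε :=
  ((tensorPerm n (Fin r → ℂ)).tprod (dhRep n ε).perm).invariants.subtype

theorem nablaIncl_injective : Function.Injective (nablaIncl r n ε) := Subtype.val_injective

theorem nablaIncl_lie {𝔤 : LieSubalgebra ℂ (Matrix (Fin r) (Fin r) ℂ)} (z : A ⊗[ℂ] 𝔤)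
    (t : Nabla r (dhRep n ε)) :
    nablaIncl r n ε ⁅z, t⁆ = currentAct (dhRep n ε) 𝔤 z (nablaIncl r n ε t) := rfl

theorem finite_nabla [Algebra.FiniteType ℂ A] : Module.Finite ℂ (Nabla r (dhRep n ε)) := by
  have := finite_DH (A := A) (n := n) (ε := ε)
  exact Module.Finite.of_injective (nablaIncl r n ε) nablaIncl_injective

theorem dhRep_act_mk (s h : ⨂[ℂ] _ : Fin n, A) :
    (dhRep n ε).act s (Ideal.Quotient.mk (harmonicIdeal n ε) h) =
      Ideal.Quotient.mk (harmonicIdeal n ε) (s * h) := rfl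

theorem tensorPerm_tprod (X : Type v) [AddCommGroup X] [Module ℂ X] (σ : Equiv.Perm (Fin n))
    (p : Fin n → X) : tensorPerm n X σ (PiTensorProduct.tprod ℂ p) =
      PiTensorProduct.tprod ℂ fun i => p (σ.symm i) :=
  PiTensorProduct.reindex_tprod σ p

theorem tmul_smul_DH (w : VTensor r n) (c : ℂ) (q : DH n ε) :
    w ⊗ₜ[ℂ] (c • q) = c • (w ⊗ₜ[ℂ] q) :=
  TensorProduct.tmul_smul c w q

theorem tprod_perm_tmul (σ : Equiv.Perm (Fin n)) (u : Fin n → Fin r → ℂ) (p : Fin n → A) :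
    (tensorPerm n (Fin r → ℂ)).tprod (dhRep n ε).perm σ (PiTensorProduct.tprod ℂ u ⊗ₜ[ℂ]
      Ideal.Quotient.mk (harmonicIdeal n ε) (PiTensorProduct.tprod ℂ p)) =
        PiTensorProduct.tprod ℂ (fun i => u (σ.symm i)) ⊗ₜ[ℂ]
          Ideal.Quotient.mk (harmonicIdeal n ε)
            (PiTensorProduct.tprod ℂ fun i => p (σ.symm i)) := by
  rw [Representation.tprod_apply, TensorProduct.map_tmul]
  congr 1
  · exact tensorPerm_tprod _ σ u
  · exact congrArg (Ideal.Quotient.mk (harmonicIdeal n ε)) (tensorPerm_tprod A σ p)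

theorem sum_act_singleAlgHom (P : A) (q : DH n ε) :
    ∑ k, (dhRep n ε).act (PiTensorProduct.singleAlgHom (R := ℂ) (A := fun _ => A) k P) q =
      (n * ε P) • q := by
  obtain ⟨h, rfl⟩ := Ideal.Quotient.mk_surjective q
  simp only [dhRep_act_mk]
  rw [← map_sum, ← Finset.sum_mul, ← powerSum, map_mul, mk_eq_tensorAug (powerSum_mem_invariants P),
    tensorAug_powerSum, ← Algebra.smul_def]

variable [NeZero r]

variable (r n ε) in
/-- The vector `e_1^{⊗n} ⊗ 1` of `∇(DH_n(A))`. -/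
def nablaGen : Nabla r (dhRep n ε) :=
  ⟨PiTensorProduct.tprod ℂ (fun _ => Pi.single 0 1) ⊗ₜ[ℂ] 1, fun σ => tprod_perm_tmul σ _ 1⟩

theorem nablaIncl_gen : nablaIncl r n ε (nablaGen r n ε) =
    PiTensorProduct.tprod ℂ (fun _ => Pi.single 0 1) ⊗ₜ[ℂ] 1 := rfl

theorem isHighestWeightVector_nablaGen (𝔤 : LieSubalgebra ℂ (Matrix (Fin r) (Fin r) ℂ)) :
    IsHighestWeightVector 𝔤 ε (n • omegaOne r) (nablaGen r n ε) := by
  intro x hx P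
  refine nablaIncl_injective ?_
  rw [nablaIncl_lie, map_smul, nablaIncl_gen, currentAct_tmul_tmul, weightEval_nsmul_omegaOne]
  have hcol : (x : Matrix (Fin r) (Fin r) ℂ).mulVec (Pi.single 0 1) =
      (x : Matrix (Fin r) (Fin r) ℂ) 0 0 • Pi.single 0 1 := by
    ext i
    by_cases hi : i = 0
    · subst hi; simp
    · simp [hi, hx (show id 0 < id i from Fin.pos_iff_ne_zero.2 hi)]
  have hk : ∀ k : Fin n, PiTensorProduct.tprod ℂ (Function.update (fun _ : Fin n =>
      (Pi.single 0 1 : Fin r → ℂ)) k ((x : Matrix (Fin r) (Fin r) ℂ).mulVec (Pi.single 0 1))) =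
        (x : Matrix (Fin r) (Fin r) ℂ) 0 0 • PiTensorProduct.tprod ℂ fun _ : Fin n =>
          (Pi.single 0 1 : Fin r → ℂ) := by
    intro k
    rw [hcol, MultilinearMap.map_update_smul, Function.update_eq_self]
  simp only [hk]
  rw [← TensorProduct.tmul_sum, sum_act_singleAlgHom, tmul_smul_DH,
    ← TensorProduct.smul_tmul', smul_smul]
  congr 1
  ring

variable (r n) in
/-- The algebra homomorphism giving the action of matrices on the `k`-th factor of `V^{⊗n}`. -/
def factorAlgHom (k : Fin n) : Matrix (Fin r) (Fin r) ℂ →ₐ[ℂ] Module.End ℂ (VTensor r n) :=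
  AlgHom.ofLinearMap (factorAct r n k)
    (PiTensorProduct.ext (MultilinearMap.ext fun u => by simp [factorAct_tprod]))
    fun x y => (factorAct_mul k x y).symm

variable (r n ε) in
/-- The action of `𝔤𝔩_r ⊗ A` on the `k`-th factor of `V^{⊗n} ⊗ DH_n(A)`. -/
def placeHom (k : Fin n) :
    A ⊗[ℂ] Matrix (Fin r) (Fin r) ℂ →ₐ[ℂ] Module.End ℂ (VTensor r n ⊗[ℂ] DH n ε) :=
  Algebra.TensorProduct.lift
    ((Module.End.lTensorAlgHom ℂ (DH n ε) (VTensor r n)).comp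
      ((dhRep n ε).act.comp (PiTensorProduct.singleAlgHom (R := ℂ) (A := fun _ => A) k)))
    ((Module.End.rTensorAlgHom ℂ (VTensor r n) (DH n ε)).comp (factorAlgHom r n k))
    fun _ _ => TensorProduct.ext' fun _ _ => rfl

omit [NeZero r] in
theorem placeHom_tmul (k : Fin n) (P : A) (x : Matrix (Fin r) (Fin r) ℂ) :
    placeHom r n ε k (P ⊗ₜ x) = TensorProduct.map (factorAct r n k x)
      ((dhRep n ε).act (PiTensorProduct.singleAlgHom (R := ℂ) (A := fun _ => A) k P)) := by
  refine TensorProduct.ext' fun w q => ?_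
  simp [placeHom]
  rfl

omit [NeZero r] in
theorem placeHom_commute {k l : Fin n} (h : k ≠ l) (c d : A ⊗[ℂ] Matrix (Fin r) (Fin r) ℂ) :
    Commute (placeHom r n ε k c) (placeHom r n ε l d) := by
  induction c using TensorProduct.induction_on with
  | zero => rw [map_zero]; exact Commute.zero_left _
  | add c₁ c₂ h₁ h₂ => rw [map_add]; exact h₁.add_left h₂
  | tmul P x =>
    induction d using TensorProduct.induction_on with
    | zero => rw [map_zero]; exact Commute.zero_right _
    | add c₁ c₂ h₁ h₂ => rw [map_add]; exact h₁.add_right h₂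
    | tmul Q z =>
      rw [placeHom_tmul, placeHom_tmul, Commute, SemiconjBy, ← TensorProduct.map_mul,
        ← TensorProduct.map_mul, factorAct_comm h, ← map_mul, ← map_mul, mul_comm]

/-- The column u_j ⊗ p_j turns e_0 ⊗ 1 at its place into u_j ⊗ p_j, so distributing the columns over
all places symmetrises the pure tensor. -/
theorem sum_tprod_perm_tmul (u : Fin n → Fin r → ℂ) (p : Fin n → A) :
    ∑ σ, (tensorPerm n (Fin r → ℂ)).tprod (dhRep n ε).perm σ (PiTensorProduct.tprod ℂ u ⊗ₜ[ℂ]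
      Ideal.Quotient.mk (harmonicIdeal n ε) (PiTensorProduct.tprod ℂ p)) =
    normalProd (∑ k, (placeHom r n ε k).toLinearMap) (nablaIncl r n ε (nablaGen r n ε)) n
      fun j => columnMap r A (u j) (p j) := by
  have hv : ∀ v : Fin r → ℂ,
      (Matrix.vecMulVec v (Pi.single (0 : Fin r) (1 : ℂ))).mulVec (Pi.single 0 1) = v :=
    fun v => by rw [Matrix.vecMulVec_mulVec]; simp
  have h := normalProd_eq_sum_perm (B := A ⊗[ℂ] Matrix (Fin r) (Fin r) ℂ)
    (N := VTensor r n ⊗[ℂ] DH n ε) (X := (Fin r → ℂ) × A)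
    (β := ∑ k, (placeHom r n ε k).toLinearMap) (ι := placeHom r n ε)
    (G := fun g => PiTensorProduct.tprod ℂ (fun i => (g i).1) ⊗ₜ[ℂ]
      Ideal.Quotient.mk (harmonicIdeal n ε) (PiTensorProduct.tprod ℂ fun i => (g i).2))
    (φ := fun d : (Fin r → ℂ) × A => columnMap r A d.1 d.2)
    (a := fun d x => ((Matrix.vecMulVec d.1 (Pi.single 0 1)).mulVec x.1, d.2 * x.2))
    (fun k d g => by
      rw [columnMap_apply, placeHom_tmul, TensorProduct.map_tmul, factorAct_tprod, dhRep_act_mk,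
        singleAlgHom_mul_tprod]
      congr 2
      · ext i : 1
        by_cases hi : i = k
        · subst hi; simp
        · simp [hi]
      · congr 1
        ext i : 1
        by_cases hi : i = k
        · subst hi; simp
        · simp [hi])
    (fun i j hij c d => placeHom_commute hij c d) (fun c => by simp)
    (fun _ => (Pi.single 0 1, 1)) (fun j => (u j, p j))
  refine Eq.trans (Finset.sum_congr rfl fun σ _ => ?_) h.symm
  rw [tprod_perm_tmul]
  congr 2
  · ext i : 1
    exact (hv _).symm
  · simp

/-- Since P ⊗ 1 acts by the scalar n ε(P), a submodule over 𝔤 ⊗ A is stable under 𝔤𝔩_r ⊗ A. It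
therefore contains all normally ordered products on the generator, hence all symmetrisations, and
these exhaust the invariants because n! is invertible. -/
theorem lieSpan_nablaGen {𝔤 : LieSubalgebra ℂ (Matrix (Fin r) (Fin r) ℂ)} (h𝔤 : sl r ≤ 𝔤) :
    LieSubmodule.lieSpan ℂ (A ⊗[ℂ] 𝔤) {nablaGen r n ε} = ⊤ := by
  set S := LieSubmodule.lieSpan ℂ (A ⊗[ℂ] 𝔤) {nablaGen r n ε}
  set S' := S.toSubmodule.map (nablaIncl r n ε) with hS'
  set β := ∑ k, (placeHom r n ε k).toLinearMap
  have hβ : ∀ P x, β (P ⊗ₜ[ℂ] x) = ∑ k, TensorProduct.map (factorAct r n k x)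
      ((dhRep n ε).act (PiTensorProduct.singleAlgHom (R := ℂ) (A := fun _ => A) k P)) :=
    fun P x => by
      simp only [β, LinearMap.sum_apply, AlgHom.toLinearMap_apply, placeHom_tmul]
  have hone : ∀ (P : A) (t : VTensor r n ⊗[ℂ] DH n ε), β (P ⊗ₜ 1) t = (n * ε P) • t := by
    intro P t
    have hf : ∀ k : Fin n, factorAct r n k 1 = 1 := fun k => (factorAlgHom r n k).map_one
    induction t using TensorProduct.induction_on with
    | zero => simp
    | add t₁ t₂ h₁ h₂ => rw [map_add, h₁, h₂, smul_add]
    | tmul w q =>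
      rw [hβ, LinearMap.sum_apply]
      simp only [TensorProduct.map_tmul, hf, Module.End.one_apply]
      rw [← TensorProduct.tmul_sum, sum_act_singleAlgHom, tmul_smul_DH]
  have hmem : ∀ c, ∀ m ∈ S', β c m ∈ S' := by
    intro c m hm
    induction c using TensorProduct.induction_on with
    | zero => simp
    | add c₁ c₂ h₁ h₂ => rw [map_add]; exact add_mem h₁ h₂
    | tmul P x =>
      have hx : x = tracelessPart h𝔤 x + (x.trace * (r : ℂ)⁻¹) • 1 := by
        rw [coe_tracelessPart, sub_add_cancel]
      rw [hx, TensorProduct.tmul_add, map_add, TensorProduct.tmul_smul, map_smul]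
      refine add_mem ?_ ?_
      · obtain ⟨t, ht, rfl⟩ := hm
        refine ⟨⁅P ⊗ₜ[ℂ] tracelessPart h𝔤 x, t⁆, S.lie_mem ht, ?_⟩
        rw [nablaIncl_lie, currentAct_tmul, hβ]
      · rw [LinearMap.smul_apply, hone]
        exact S'.smul_mem _ (S'.smul_mem _ hm)
  have hsum : ∀ t : VTensor r n ⊗[ℂ] DH n ε,
      ∑ σ, (tensorPerm n (Fin r → ℂ)).tprod (dhRep n ε).perm σ t ∈ S' := by
    intro t
    induction t using TensorProduct.induction_on with
    | zero => simp
    | add t₁ t₂ h₁ h₂ =>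
      simp only [map_add, Finset.sum_add_distrib]
      exact add_mem h₁ h₂
    | tmul w q =>
      obtain ⟨h, rfl⟩ := Ideal.Quotient.mk_surjective q
      induction w using PiTensorProduct.induction_on with
      | add w₁ w₂ h₁ h₂ =>
        simp only [TensorProduct.add_tmul, map_add, Finset.sum_add_distrib]
        exact add_mem h₁ h₂
      | smul_tprod c u =>
        simp only [← TensorProduct.smul_tmul', map_smul, ← Finset.smul_sum]
        refine S'.smul_mem c ?_
        induction h using PiTensorProduct.induction_on with
        | add w₁ w₂ h₁ h₂ =>
          simp only [TensorProduct.tmul_add, map_add, Finset.sum_add_distrib]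
          exact add_mem h₁ h₂
        | smul_tprod d p =>
          have hd : Ideal.Quotient.mk (harmonicIdeal n ε) (d • PiTensorProduct.tprod ℂ p) =
              d • Ideal.Quotient.mk (harmonicIdeal n ε) (PiTensorProduct.tprod ℂ p) := rfl
          simp only [hd, tmul_smul_DH, map_smul, ← Finset.smul_sum]
          refine S'.smul_mem d ?_
          rw [sum_tprod_perm_tmul]
          exact normalProd_mem S' hmem
            ⟨_, LieSubmodule.subset_lieSpan (Set.mem_singleton _), rfl⟩ _
  rw [eq_top_iff]
  rintro t -
  have ht := hsum (nablaIncl r n ε t)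
  have hinv : ∀ σ, (tensorPerm n (Fin r → ℂ)).tprod (dhRep n ε).perm σ (nablaIncl r n ε t) =
      nablaIncl r n ε t := t.2
  rw [Finset.sum_congr rfl fun σ _ => hinv σ, Finset.sum_const, Finset.card_univ,
    ← Nat.cast_smul_eq_nsmul ℂ] at ht
  have hc : (Fintype.card (Equiv.Perm (Fin n)) : ℂ) ≠ 0 := Nat.cast_ne_zero.2 Fintype.card_ne_zero
  rw [Submodule.smul_mem_iff _ hc] at ht
  obtain ⟨t', ht', h⟩ := ht
  rwa [← nablaIncl_injective h]

end NablaHarmonics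

/-! ### The universal property of `∇(DH_n(A))` -/

section Universal

variable {r : ℕ} [NeZero r] {A : Type u} [CommRing A] [Algebra ℂ A] {n : ℕ} {ε : A →ₐ[ℂ] ℂ}
  {𝔤 : LieSubalgebra ℂ (Matrix (Fin r) (Fin r) ℂ)}
  {N : Type*} [AddCommGroup N] [Module ℂ N] [LieRingModule (A ⊗[ℂ] 𝔤) N]
  [LieModule ℂ (A ⊗[ℂ] 𝔤) N]

theorem exists_nablaHom [Module.Finite ℂ N] (h𝔤 : sl r ≤ 𝔤) {y : N}
    (hy : IsHighestWeightVector 𝔤 ε (n • omegaOne r) y)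
    (hgen : LieSubmodule.lieSpan ℂ (A ⊗[ℂ] 𝔤) {y} = ⊤) :
    ∃ f : Nabla r (dhRep n ε) →ₗ⁅ℂ, A ⊗[ℂ] 𝔤⁆ N, f (nablaGen r n ε) = y := by
  set β := extendedAct N h𝔤 ε n
  have hvan : normalProd β y (n + 1) = 0 := normalProd_extendedAct_eq_zero h𝔤 hy
  have h0 := extendedAct_unit_zero_zero h𝔤 hy
  set F := harmonicSymbolMap (extendedAct_lie h𝔤 ε n) hvan h0
  have hF : ∀ (z : A ⊗[ℂ] 𝔤) (t : VTensor r n ⊗[ℂ] DH n ε),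
      F (currentAct (dhRep n ε) 𝔤 z t) = ⁅z, F t⁆ := by
    intro z t
    induction t using TensorProduct.induction_on with
    | zero => simp
    | add t₁ t₂ h₁ h₂ => simp only [map_add, lie_add, h₁, h₂]
    | tmul w q =>
      obtain ⟨h, rfl⟩ := Ideal.Quotient.mk_surjective q
      induction z using TensorProduct.induction_on with
      | zero => simp
      | add z₁ z₂ h₁ h₂ => simp only [map_add, LinearMap.add_apply, add_lie, h₁, h₂]
      | tmul P x =>
        rw [currentAct_tmul, LinearMap.sum_apply, map_sum, ← extendedAct_tmul_coe h𝔤 hy hgen,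
          harmonicSymbolMap_tmul, apply_symbolMap hvan]
        rfl
  -- The normalisation cancels the falling factorial n! arising from n factors E_{00} on y.
  let f : Nabla r (dhRep n ε) →ₗ[ℂ] N := ((n.factorial : ℂ)⁻¹ • F) ∘ₗ nablaIncl r n ε
  refine ⟨{ f with map_lie' := fun {z t} => ?_ }, ?_⟩
  · change (n.factorial : ℂ)⁻¹ • F (nablaIncl r n ε ⁅z, t⁆) =
      ⁅z, (n.factorial : ℂ)⁻¹ • F (nablaIncl r n ε t)⁆
    rw [nablaIncl_lie, hF, lie_smul]
  · change (n.factorial : ℂ)⁻¹ • F (nablaIncl r n ε (nablaGen r n ε)) = y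
    have h1 : (1 : DH n ε) = Ideal.Quotient.mk (harmonicIdeal n ε)
      (PiTensorProduct.tprod ℂ fun _ => 1) := rfl
    have hcol : columnMap r A (Pi.single 0 1) 1 = unit 1 0 0 := by
      rw [columnMap_apply, unit]
      congr 1
      ext i j
      simp [Matrix.vecMulVec_apply, Matrix.single_apply, Pi.single_apply, eq_comm (a := (0 : Fin r)), ite_and]
      split_ifs <;> rfl
    rw [nablaIncl_gen, h1, harmonicSymbolMap_tmul, symbolMap_tprod, hcol,
      normalProd_unit_zero_zero h0]
    simp [Nat.descFactorial_self, smul_smul, Nat.factorial_ne_zero]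

theorem isWeylModule_nabla [Algebra.FiniteType ℂ A] (h𝔤 : sl r ≤ 𝔤) :
    IsWeylModule.{u, u, w} 𝔤 ε (n • omegaOne r) (Nabla r (dhRep n ε)) (nablaGen r n ε) where
  finite := finite_nabla
  highest := isHighestWeightVector_nablaGen 𝔤
  generated := lieSpan_nablaGen h𝔤
  universal N _ _ _ _ y _ hy hgen := by
    obtain ⟨f, hf⟩ := exists_nablaHom h𝔤 hy hgen
    refine ⟨f, hf, ?_⟩
    rw [← LieModuleHom.range_eq_top, eq_top_iff, ← hgen, LieSubmodule.lieSpan_le,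
      Set.singleton_subset_iff]
    exact ⟨_, hf⟩

end Universal

/-! ### Modules over the enveloping algebra -/

section Enveloping

variable {L : Type u} [LieRing L] [LieAlgebra ℂ L]

/-- The lift of L → S, followed by the inclusion, agrees with the identity on L, hence everywhere.
This serves as an induction principle for the enveloping algebra. -/
theorem enveloping_eq_top (S : Subalgebra ℂ (UniversalEnvelopingAlgebra ℂ L))
    (hS : ∀ z : L, UniversalEnvelopingAlgebra.ι ℂ z ∈ S) : S = ⊤ := by
  let g : L →ₗ⁅ℂ⁆ S :=
    { toFun := fun z => ⟨UniversalEnvelopingAlgebra.ι ℂ z, hS z⟩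
      map_add' := fun z w => Subtype.ext (map_add _ z w)
      map_smul' := fun c z => Subtype.ext (map_smul _ c z)
      map_lie' := fun {z w} => Subtype.ext (LieHom.map_lie _ z w) }
  have h : S.val.comp (UniversalEnvelopingAlgebra.lift ℂ g) = AlgHom.id ℂ _ := by
    refine UniversalEnvelopingAlgebra.hom_ext ℂ (LieHom.ext fun z => ?_)
    change ((UniversalEnvelopingAlgebra.lift ℂ g (UniversalEnvelopingAlgebra.ι ℂ z) : S) :
      UniversalEnvelopingAlgebra ℂ L) = UniversalEnvelopingAlgebra.ι ℂ z
    rw [UniversalEnvelopingAlgebra.lift_ι_apply]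
    rfl
  rw [eq_top_iff]
  rintro x -
  have hx := AlgHom.congr_fun h x
  rw [AlgHom.id_apply] at hx
  rw [← hx]
  exact (UniversalEnvelopingAlgebra.lift ℂ g x).2

variable {M N : Type*} [AddCommGroup M] [Module ℂ M] [LieRingModule L M] [LieModule ℂ L M]

/-- The action of the enveloping algebra on a Lie module. -/
def envelopingAct (L : Type u) [LieRing L] [LieAlgebra ℂ L] (M : Type*) [AddCommGroup M]
    [Module ℂ M] [LieRingModule L M] [LieModule ℂ L M] :
    UniversalEnvelopingAlgebra ℂ L →ₐ[ℂ] Module.End ℂ M :=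
  UniversalEnvelopingAlgebra.lift ℂ (LieModule.toEnd ℂ L M)

theorem envelopingAct_ι (z : L) (m : M) :
    envelopingAct L M (UniversalEnvelopingAlgebra.ι ℂ z) m = ⁅z, m⁆ := by
  rw [envelopingAct, UniversalEnvelopingAlgebra.lift_ι_apply, LieModule.toEnd_apply_apply]

theorem envelopingAct_mem (S : LieSubmodule ℂ L M) (u : UniversalEnvelopingAlgebra ℂ L) {m : M}
    (hm : m ∈ S) : envelopingAct L M u m ∈ S := by
  let T : Subalgebra ℂ (UniversalEnvelopingAlgebra ℂ L) :=
    { carrier := {u | ∀ m ∈ S, envelopingAct L M u m ∈ S}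
      mul_mem' := fun {u v} (hu : ∀ m ∈ S, _) (hv : ∀ m ∈ S, _) m hm => by
        rw [map_mul]; exact hu _ (hv m hm)
      add_mem' := fun {u v} (hu : ∀ m ∈ S, _) (hv : ∀ m ∈ S, _) m hm => by
        rw [map_add]; exact S.add_mem (hu m hm) (hv m hm)
      algebraMap_mem' := fun c m hm => by
        rw [AlgHom.commutes]; exact S.smul_mem c hm }
  have hT : T = ⊤ := enveloping_eq_top T fun z m hm => by
    rw [envelopingAct_ι]; exact S.lie_mem hm
  have hu : u ∈ T := hT ▸ Algebra.mem_top
  exact hu m hm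

theorem map_envelopingAct [AddCommGroup N] [Module ℂ N] [LieRingModule L N] [LieModule ℂ L N]
    (f : M →ₗ⁅ℂ, L⁆ N) (u : UniversalEnvelopingAlgebra ℂ L) (m : M) :
    f (envelopingAct L M u m) = envelopingAct L N u (f m) := by
  let T : Subalgebra ℂ (UniversalEnvelopingAlgebra ℂ L) :=
    { carrier := {u | ∀ m, f (envelopingAct L M u m) = envelopingAct L N u (f m)}
      mul_mem' := fun {u v} (hu : ∀ m, _) (hv : ∀ m, _) m => by
        rw [map_mul, map_mul, Module.End.mul_apply, Module.End.mul_apply, hu, hv]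
      add_mem' := fun {u v} (hu : ∀ m, _) (hv : ∀ m, _) m => by
        rw [map_add, map_add, LinearMap.add_apply, LinearMap.add_apply, map_add, hu, hv]
      algebraMap_mem' := fun c m => by
        rw [AlgHom.commutes, AlgHom.commutes, Module.algebraMap_end_apply,
          Module.algebraMap_end_apply, map_smul] }
  have hT : T = ⊤ := enveloping_eq_top T fun z m => by
    rw [envelopingAct_ι, envelopingAct_ι, LieModuleHom.map_lie]
  have hu : u ∈ T := hT ▸ Algebra.mem_top
  exact hu m

theorem envelopingAct_surjective {m : M} (hm : LieSubmodule.lieSpan ℂ L {m} = ⊤) :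
    Function.Surjective fun u => envelopingAct L M u m := by
  let S : LieSubmodule ℂ L M :=
    { LinearMap.range ((LinearMap.applyₗ m) ∘ₗ (envelopingAct L M).toLinearMap) with
      lie_mem := by
        rintro z _ ⟨u, rfl⟩
        refine ⟨UniversalEnvelopingAlgebra.ι ℂ z * u, ?_⟩
        change envelopingAct L M (_ * u) m = ⁅z, envelopingAct L M u m⁆
        rw [map_mul, Module.End.mul_apply, envelopingAct_ι] }
  have hS : LieSubmodule.lieSpan ℂ L {m} ≤ S := by
    rw [LieSubmodule.lieSpan_le, Set.singleton_subset_iff]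
    refine ⟨1, ?_⟩
    change envelopingAct L M 1 m = m
    rw [map_one, Module.End.one_apply]
  intro x
  have hx : x ∈ S := hS (hm ▸ LieSubmodule.mem_top x)
  exact hx

end Enveloping

/-! ### The Weyl module and `∇(DH_n(A))` -/

section Weyl

variable {r : ℕ} {A : Type u} [CommRing A] [Algebra ℂ A]
  {𝔤 : LieSubalgebra ℂ (Matrix (Fin r) (Fin r) ℂ)} {ε : A →ₐ[ℂ] ℂ} {lam : Fin r → ℂ}

theorem IsWeylModule.of_equiv {M : Type v} [AddCommGroup M] [Module ℂ M]
    [LieRingModule (A ⊗[ℂ] 𝔤) M] [LieModule ℂ (A ⊗[ℂ] 𝔤) M] {M' : Type v} [AddCommGroup M']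
    [Module ℂ M'] [LieRingModule (A ⊗[ℂ] 𝔤) M'] [LieModule ℂ (A ⊗[ℂ] 𝔤) M'] {m : M}
    (h : IsWeylModule.{u, v, w} 𝔤 ε lam M m) (e : M ≃ₗ⁅ℂ, A ⊗[ℂ] 𝔤⁆ M') :
    IsWeylModule.{u, v, w} 𝔤 ε lam M' (e m) where
  finite := by
    have := h.finite
    exact Module.Finite.equiv e.toLinearEquiv
  highest x hx P := by
    have := congrArg e (h.highest x hx P)
    exact (LieModuleHom.map_lie e.toLieModuleHom _ _).symm.trans
      (this.trans (e.toLieModuleHom.map_smul _ _))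
  generated := by
    have hle : LieSubmodule.lieSpan ℂ (A ⊗[ℂ] 𝔤) {m} ≤
        (LieSubmodule.lieSpan ℂ (A ⊗[ℂ] 𝔤) {e m}).comap e.toLieModuleHom := by
      rw [LieSubmodule.lieSpan_le, Set.singleton_subset_iff]
      exact LieSubmodule.subset_lieSpan (Set.mem_singleton (e m))
    rw [eq_top_iff]
    rintro x -
    have hx : e.symm x ∈ LieSubmodule.lieSpan ℂ (A ⊗[ℂ] 𝔤) {m} := by
      rw [h.generated]; exact LieSubmodule.mem_top _
    have := hle hx
    rw [LieSubmodule.mem_comap] at this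
    convert this
    exact (e.apply_symm_apply x).symm
  universal N _ _ _ _ y hN hy hgen := by
    obtain ⟨f, hf, hsurj⟩ := h.universal N y hN hy hgen
    refine ⟨f.comp e.symm.toLieModuleHom, ?_, ?_⟩
    · refine Eq.trans ?_ hf
      exact congrArg f (e.symm_apply_apply m)
    · exact hsurj.comp e.symm.surjective

variable {M : Type u} [AddCommGroup M] [Module ℂ M] [LieRingModule (A ⊗[ℂ] 𝔤) M]
  [LieModule ℂ (A ⊗[ℂ] 𝔤) M] {m : M}

/-- The annihilator of m is one of the left ideals being intersected. Conversely each such ideal I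
gives a finite-dimensional highest weight module U/I, and a map M → U/I taking m to the class of 1
shows that the annihilator lies in I. -/
theorem mem_weylIdeal_iff (h : IsWeylModule.{u, u, u} 𝔤 ε lam M m)
    (u : UniversalEnvelopingAlgebra ℂ (A ⊗[ℂ] 𝔤)) :
    u ∈ weylIdeal 𝔤 ε lam ↔ envelopingAct (A ⊗[ℂ] 𝔤) M u m = 0 := by
  constructor
  · intro hu
    let φ : UniversalEnvelopingAlgebra ℂ (A ⊗[ℂ] 𝔤) →ₗ[ℂ] M :=
      (LinearMap.applyₗ m) ∘ₗ (envelopingAct (A ⊗[ℂ] 𝔤) M).toLinearMap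
    let I : Submodule (UniversalEnvelopingAlgebra ℂ (A ⊗[ℂ] 𝔤))
        (UniversalEnvelopingAlgebra ℂ (A ⊗[ℂ] 𝔤)) :=
      { LinearMap.ker φ with
        smul_mem' := fun c x (hx : envelopingAct (A ⊗[ℂ] 𝔤) M x m = 0) => by
          change envelopingAct (A ⊗[ℂ] 𝔤) M (c * x) m = 0
          rw [map_mul, Module.End.mul_apply, hx, map_zero] }
    have hI : I.restrictScalars ℂ = LinearMap.ker φ := rfl
    have hmem : u ∈ I := by
      refine Submodule.mem_sInf.1 hu I ⟨?_, ?_⟩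
      · rintro _ ⟨x, P, hx, rfl⟩
        change envelopingAct (A ⊗[ℂ] 𝔤) M (_ - _) m = 0
        rw [map_sub, LinearMap.sub_apply, envelopingAct_ι, AlgHom.commutes, h.highest x hx,
          Module.algebraMap_end_apply, sub_self]
      · have := h.finite
        have hfin : Module.Finite ℂ (UniversalEnvelopingAlgebra ℂ (A ⊗[ℂ] 𝔤) ⧸
            I.restrictScalars ℂ) := by
          rw [hI]
          exact Module.Finite.equiv φ.quotKerEquivRange.symm
        exact Module.Finite.equiv (Submodule.Quotient.restrictScalarsEquiv ℂ I)
    exact hmem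
  · intro hu
    refine Submodule.mem_sInf.2 fun I hI => ?_
    obtain ⟨hrel, hfin⟩ := hI
    let : LieRingModule (UniversalEnvelopingAlgebra ℂ (A ⊗[ℂ] 𝔤))
        (UniversalEnvelopingAlgebra ℂ (A ⊗[ℂ] 𝔤) ⧸ I) := LieRingModule.ofAssociativeModule
    have : LieModule ℂ (UniversalEnvelopingAlgebra ℂ (A ⊗[ℂ] 𝔤))
        (UniversalEnvelopingAlgebra ℂ (A ⊗[ℂ] 𝔤) ⧸ I) := LieModule.ofAssociativeModule
    let : LieRingModule (A ⊗[ℂ] 𝔤) (UniversalEnvelopingAlgebra ℂ (A ⊗[ℂ] 𝔤) ⧸ I) :=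
      LieRingModule.compLieHom _ (UniversalEnvelopingAlgebra.ι ℂ)
    have : LieModule ℂ (A ⊗[ℂ] 𝔤) (UniversalEnvelopingAlgebra ℂ (A ⊗[ℂ] 𝔤) ⧸ I) :=
      LieModule.compLieHom _ (UniversalEnvelopingAlgebra.ι ℂ)
    have hact : ∀ x y : UniversalEnvelopingAlgebra ℂ (A ⊗[ℂ] 𝔤),
        envelopingAct (A ⊗[ℂ] 𝔤) (UniversalEnvelopingAlgebra ℂ (A ⊗[ℂ] 𝔤) ⧸ I) x
          (Submodule.Quotient.mk y) = Submodule.Quotient.mk (x * y) := by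
      intro x
      let T : Subalgebra ℂ (UniversalEnvelopingAlgebra ℂ (A ⊗[ℂ] 𝔤)) :=
        { carrier := {x | ∀ y, envelopingAct (A ⊗[ℂ] 𝔤)
            (UniversalEnvelopingAlgebra ℂ (A ⊗[ℂ] 𝔤) ⧸ I) x
              (Submodule.Quotient.mk y) = Submodule.Quotient.mk (x * y)}
          mul_mem' := fun {a b} (ha : ∀ y, _) (hb : ∀ y, _) y => by
            rw [map_mul, Module.End.mul_apply, hb, ha, mul_assoc]
          add_mem' := fun {a b} (ha : ∀ y, _) (hb : ∀ y, _) y => by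
            rw [map_add, LinearMap.add_apply, hb, ha, add_mul, Submodule.Quotient.mk_add]
          algebraMap_mem' := fun c y => by
            rw [AlgHom.commutes, Module.algebraMap_end_apply, ← Algebra.smul_def]
            rfl }
      have hT : T = ⊤ := enveloping_eq_top T fun z y => by
        rw [envelopingAct_ι]
        rfl
      have hx : x ∈ T := hT ▸ Algebra.mem_top
      exact hx
    have hy : IsHighestWeightVector 𝔤 ε lam
        (Submodule.Quotient.mk 1 : UniversalEnvelopingAlgebra ℂ (A ⊗[ℂ] 𝔤) ⧸ I) := by
      intro x hx P
      have hI := hrel ⟨x, P, hx, rfl⟩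
      have h1 := (Submodule.Quotient.eq I).2 hI
      rw [← envelopingAct_ι, hact, mul_one, h1, Algebra.algebraMap_eq_smul_one]
      rfl
    have hgen : LieSubmodule.lieSpan ℂ (A ⊗[ℂ] 𝔤)
        {(Submodule.Quotient.mk 1 : UniversalEnvelopingAlgebra ℂ (A ⊗[ℂ] 𝔤) ⧸ I)} = ⊤ := by
      rw [eq_top_iff]
      rintro x -
      obtain ⟨x, rfl⟩ := Submodule.Quotient.mk_surjective I x
      have hx := hact x 1
      rw [mul_one] at hx
      rw [← hx]
      exact envelopingAct_mem _ _ (LieSubmodule.subset_lieSpan (Set.mem_singleton _))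
    obtain ⟨f, hf, -⟩ := h.universal _ _ hfin hy hgen
    have := map_envelopingAct f u m
    rw [hu, map_zero, hf, hact, mul_one, eq_comm, Submodule.Quotient.mk_eq_zero] at this
    exact this

/-- Both modules are cyclic quotients of the enveloping algebra, and by `mem_weylIdeal_iff` they
have the same kernel. -/
theorem exists_weylModule_equiv (h : IsWeylModule.{u, u, u} 𝔤 ε lam M m) :
    ∃ e : M ≃ₗ⁅ℂ, A ⊗[ℂ] 𝔤⁆ WeylModule 𝔤 ε lam, e m = WeylModule.gen 𝔤 ε lam := by
  let φ : UniversalEnvelopingAlgebra ℂ (A ⊗[ℂ] 𝔤) →ₗ[ℂ] M :=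
    (LinearMap.applyₗ m) ∘ₗ (envelopingAct (A ⊗[ℂ] 𝔤) M).toLinearMap
  let q : UniversalEnvelopingAlgebra ℂ (A ⊗[ℂ] 𝔤) →ₗ[ℂ] WeylModule 𝔤 ε lam :=
    (weylIdeal 𝔤 ε lam).mkQ.restrictScalars ℂ
  have hq : ∀ z x, q (UniversalEnvelopingAlgebra.ι ℂ z * x) = ⁅z, q x⁆ := fun _ _ => rfl
  have hφ : ∀ z x, φ (UniversalEnvelopingAlgebra.ι ℂ z * x) = ⁅z, φ x⁆ := fun z x => by
    change envelopingAct (A ⊗[ℂ] 𝔤) M (_ * x) m = ⁅z, envelopingAct (A ⊗[ℂ] 𝔤) M x m⁆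
    rw [map_mul, Module.End.mul_apply, envelopingAct_ι]
  have hφs : Function.Surjective φ := envelopingAct_surjective h.generated
  have hqs : Function.Surjective q := Submodule.Quotient.mk_surjective _
  have hker : LinearMap.ker φ = LinearMap.ker q := by
    ext x
    rw [LinearMap.mem_ker, LinearMap.mem_ker]
    exact (mem_weylIdeal_iff h x).symm.trans (Submodule.Quotient.mk_eq_zero _).symm
  let e : M ≃ₗ[ℂ] WeylModule 𝔤 ε lam := (φ.quotKerEquivOfSurjective hφs).symm ≪≫ₗ
    Submodule.quotEquivOfEq _ _ hker ≪≫ₗ q.quotKerEquivOfSurjective hqs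
  have he : ∀ x, e (φ x) = q x := fun x => by
    have : (φ.quotKerEquivOfSurjective hφs).symm (φ x) = Submodule.Quotient.mk x := by
      rw [LinearEquiv.symm_apply_eq]
      rfl
    simp only [e, LinearEquiv.trans_apply, this]
    rfl
  refine ⟨{ e with map_lie' := fun {z t} => ?_ }, ?_⟩
  · obtain ⟨x, rfl⟩ := hφs t
    change e ⁅z, φ x⁆ = ⁅z, e (φ x)⁆
    rw [← hφ, he, he, hq]
  · have h1 : φ 1 = m := by
      change envelopingAct (A ⊗[ℂ] 𝔤) M 1 m = m
      rw [map_one, Module.End.one_apply]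
    change e m = q 1
    rw [← he, h1]

end Weyl

end WeylDuality

end

theorem theorem1p4 (r : ℕ) [NeZero r] (n : ℕ) {A : Type u} [CommRing A] [Algebra ℂ A]
    [Algebra.FiniteType ℂ A] (ε : A →ₐ[ℂ] ℂ)
    (𝔤 : LieSubalgebra ℂ (Matrix (Fin r) (Fin r) ℂ))
    (h𝔤 : 𝔤 = WeylDuality.sl r ∨ 𝔤 = WeylDuality.gl r) :
    WeylDuality.IsWeylModule.{u, u, w} 𝔤 ε (n • WeylDuality.omegaOne r)
        (WeylDuality.WeylModule 𝔤 ε (n • WeylDuality.omegaOne r))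
        (WeylDuality.WeylModule.gen 𝔤 ε (n • WeylDuality.omegaOne r)) ∧
      Nonempty (WeylDuality.WeylModule 𝔤 ε (n • WeylDuality.omegaOne r)
        ≃ₗ⁅ℂ, A ⊗[ℂ] 𝔤⁆ WeylDuality.Nabla r (WeylDuality.dhRep n ε)) := by
  have hsl : WeylDuality.sl r ≤ 𝔤 := by
    rcases h𝔤 with rfl | rfl
    · exact le_rfl
    · exact le_top
  obtain ⟨e, he⟩ :=
    WeylDuality.exists_weylModule_equiv (WeylDuality.isWeylModule_nabla (n := n) (ε := ε) hsl)
  refine ⟨?_, ⟨e.symm⟩⟩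
  rw [← he]
  -- The equivalence was built from universality in universe u alone; universality in universe w is
  -- taken afresh from the harmonics and transported along e.
  exact (WeylDuality.isWeylModule_nabla hsl).of_equiv e
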